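/- Conventions. "Formula" means positive existential formula (built from atomic formulas, including equalities, with $\top,\bot,\wedge,\vee,\exists$), and $T$ is a positive (h-inductive) theory: a set of sentences $\forall x(\varphi(x)\to\psi(x))$ with $\varphi,\psi$ positive. We work in a monster model $\mathfrak M$ of $T$, i.e. for a suitably large cardinal $\kappa$ (with $\kappa>|L|$ and $\beth_{(2^\mu)^+}<\kappa$ for all $\mu<\kappa$), $\mathfrak M$ is an existentially closed model of $T$ that is $\kappa$-saturated for positive formulas and in which any two tuples of length $<\kappa$ with the same positive type are conjugate under an automorphism. "Small" means of size $<\kappa$; parameter sets and tuples (possibly infinite) are small. Global types are maximal consistent sets of positive formulas over $\mathfrak M$; their realisations are taken in a bigger monster model $\mathfrak N$ of $T$ extending $\mathfrak M$ (a monster with respect to some $\kappa'\ge\kappa$ with $\kappa'>|\mathfrak M|$). For tuples $a,b$ write $d_C(a,b)\le n$ if there are $a=a_0,\dots,a_n=b$ such that $a_i,a_{i+1}$ are on a common $C$-indiscernible sequence for all $i<n$, and $a\equiv^{\mathrm{Ls}}_C b$ if $d_C(a,b)\le n$ for some $n<\omega$. The theory $T$ is thick if there is a partial type $\Theta((x_i)_{i<\omega})$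 (for each length of the tuples $x_i$) whose realisations in $\mathfrak M$ are exactly the indiscernible sequences. A Lascar strong type $\mathrm{Lstp}(\alpha/B)$, $B\supseteq C$, is $C$-Ls-invariant if $\alpha b\equiv^{\mathrm{Ls}}_C\alpha b'$ for all small tuples $b,b'$ in $B$ with $b\equiv^{\mathrm{Ls}}_C b'$; a global type $q$ is $C$-Ls-invariant if $\mathrm{Lstp}(\alpha/\mathfrak M)$ is $C$-Ls-invariant for $\alpha\models q$. For such $q$, $(\alpha_i)_{i<\omega}\models q^{\otimes\omega}$ means that each $\alpha_i$ realises the $C$-Ls-invariant extension of $q$ to $\mathfrak M\alpha_{<i}$, i.e. $\alpha_i\models q$ and $\mathrm{Lstp}(\alpha_i/\mathfrak M\alpha_{<i})$ is $C$-Ls-invariant. A Morley sequence in $q$ (over $C$) is a sequence $(a_i)_{i<\omega}$ in $\mathfrak M$ with $(a_i)_{i<\omega}\equiv^{\mathrm{Ls}}_C(\alpha_i)_{i<\omega}$ for some $(\alpha_i)_{i<\omega}\models q^{\otimes\omega}$. Finally $a\mathop{\perp\!\!\!\perp}^{iLs}_C b$ means that $\mathrm{tp}(a/Cb)$ extends to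 a global $C$-Ls-invariant type. Proposition. Let $T$ be a thick positive theory and $C$ a small parameter set. If $(a_i)_{i<\omega}$ is a $C$-indiscernible sequence of small tuples such that $a_i\mathop{\perp\!\!\!\perp}^{iLs}_C a_{<i}$ for all $i<\omega$, then there is a global $C$-Ls-invariant type $q$ such that $(a_i)_{i<\omega}$ is a Morley sequence in $q$ over $C$. -/

import Mathlib

open FirstOrder Cardinal Set

universe u v w x y

namespace PosLogic

variable {L : FirstOrder.Language.{u, v}}

/-! ### Positive formulas, positive theories, existentially closed models -/

/-- Positive (existential) formulas: those built from atomic formulas with `⊤`, `⊥`, `∧`, `∨`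
and `∃`. -/
inductive IsPositive {α : Type x} : {n : ℕ} → L.BoundedFormula α n → Prop
  | bot {n : ℕ} : IsPositive (⊥ : L.BoundedFormula α n)
  | top {n : ℕ} : IsPositive (⊤ : L.BoundedFormula α n)
  | equal {n : ℕ} (t₁ t₂ : L.Term (α ⊕ Fin n)) :
      IsPositive (FirstOrder.Language.BoundedFormula.equal t₁ t₂)
  | rel {n l : ℕ} (R : L.Relations l) (ts : Fin l → L.Term (α ⊕ Fin n)) :
      IsPositive (FirstOrder.Language.BoundedFormula.rel R ts)
  | inf {n : ℕ} {φ ψ : L.BoundedFormula α n} : IsPositive φ → IsPositive ψ → IsPositive (φ ⊓ ψ)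
  | sup {n : ℕ} {φ ψ : L.BoundedFormula α n} : IsPositive φ → IsPositive ψ → IsPositive (φ ⊔ ψ)
  | ex {n : ℕ} {φ : L.BoundedFormula α (n + 1)} : IsPositive φ → IsPositive φ.ex

/-- An h-inductive sentence: `∀ x (φ(x) → ψ(x))` with `φ`, `ψ` positive and `x` a finite tuple. -/
def IsHInductive (σ : L.Sentence) : Prop :=
  ∃ (n : ℕ) (φ ψ : L.BoundedFormula Empty n), IsPositive φ ∧ IsPositive ψ ∧ σ = (φ.imp ψ).alls

/-- A positive theory: a set of h-inductive sentences. -/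
def IsPositiveTheory (T : L.Theory) : Prop := ∀ σ ∈ T, IsHInductive σ

/-- A homomorphism is an immersion if it preserves and reflects positive formulas. -/
def IsImmersion {M : Type w} {N : Type y} [L.Structure M] [L.Structure N] (f : M →[L] N) : Prop :=
  ∀ (n : ℕ) (φ : L.Formula (Fin n)), IsPositive φ →
    ∀ a : Fin n → M, φ.Realize (f ∘ a) ↔ φ.Realize a

/-- `M` is an existentially closed (e.c.) model of `T`: every homomorphism from `M` to a model
of `T` is an immersion. -/
structure IsECModel (T : L.Theory) (M : Type w) [L.Structure M] : Prop where
  models : M ⊨ T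
  immersion : ∀ (N : Type w) [L.Structure N], N ⊨ T → ∀ f : M →[L] N, IsImmersion f

/-- `M` is a monster model of the positive theory `T`, where "small" means "of cardinality
less than `κ`". The cardinal `κ` is large: it exceeds the size of the language and is closed under
`μ ↦ ℶ_{(2^μ)⁺}` (so it is an uncountable strong limit). -/
structure IsMonster (T : L.Theory) (κ : Cardinal.{w}) (M : Type w) [L.Structure M] : Prop where
  card_language : Cardinal.lift.{w} L.card < Cardinal.lift.{max u v} κ
  beth_lt : ∀ μ < κ, ℶ_ (Order.succ ((2 : Cardinal.{w}) ^ μ)).ord < κ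
  ec : IsECModel T M
  /-- A set of positive formulas in a small tuple of variables over a small set `B` that is
  finitely satisfiable in `M` is satisfiable in `M`. -/
  saturated : ∀ (B : Set M) (X : Type w), #B < κ → #X < κ →
    ∀ S : Set (L.Formula (B ⊕ X)), (∀ φ ∈ S, IsPositive φ) →
      (∀ F : Finset (L.Formula (B ⊕ X)), ↑F ⊆ S →
        ∃ a : X → M, ∀ φ ∈ F, φ.Realize (Sum.elim Subtype.val a)) →
      ∃ a : X → M, ∀ φ ∈ S, φ.Realize (Sum.elim Subtype.val a)
  /-- Small tuples with the same positive type are conjugate under an automorphism. -/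
  homogeneous : ∀ X : Type w, #X < κ → ∀ a b : X → M,
    (∀ φ : L.Formula X, IsPositive φ → (φ.Realize a ↔ φ.Realize b)) →
      ∃ f : M ≃[L] M, ∀ i, f (a i) = b i

/-! ### Types, indiscernible sequences, Lascar strong types, thickness -/

section Types

variable {M : Type w} [L.Structure M] {X : Type x}

variable (L) in
/-- `a ≡_C b`: the tuples `a` and `b` satisfy the same positive formulas over `C`. -/
def SameType (C : Set M) (a b : X → M) : Prop :=
  ∀ φ : L.Formula (C ⊕ X), IsPositive φ →
    (φ.Realize (Sum.elim Subtype.val a) ↔ φ.Realize (Sum.elim Subtype.val b))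

variable (L) in
/-- `(a_i)_{i < ω}` is `C`-indiscernible. -/
def IsIndiscernible (C : Set M) (a : ℕ → X → M) : Prop :=
  ∀ (n : ℕ) (f g : Fin n → ℕ), StrictMono f → StrictMono g →
    SameType L C (fun p : Fin n × X => a (f p.1) p.2) (fun p : Fin n × X => a (g p.1) p.2)

variable (L) in
/-- `d_C(a, b) ≤ n`: there are `a = s_0, …, s_n = b` such that any two consecutive tuples
are on a common `C`-indiscernible sequence. -/
def LascarDistLE (C : Set M) (n : ℕ) (a b : X → M) : Prop :=
  ∃ s : ℕ → X → M, s 0 = a ∧ s n = b ∧ ∀ i < n,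
    ∃ t : ℕ → X → M, IsIndiscernible L C t ∧ s i ∈ range t ∧ s (i + 1) ∈ range t

variable (L) in
/-- `a ≡^Ls_C b`: equality of Lascar strong types over `C`. -/
def LsEquiv (C : Set M) (a b : X → M) : Prop := ∃ n : ℕ, LascarDistLE L C n a b

variable (L M) in
/-- Thickness, read in a monster model `M`: being an indiscernible sequence (of `k`-tuples) is
type-definable. A sequence of infinite tuples is indiscernible iff all the corresponding sequences
of finite subtuples are, so finite tuples suffice. -/
def IsThick : Prop :=
  ∀ k : ℕ, ∃ Θ : Set (L.Formula (ℕ × Fin k)), (∀ φ ∈ Θ, IsPositive φ) ∧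
    ∀ a : ℕ → Fin k → M,
      (∀ φ ∈ Θ, φ.Realize (fun p : ℕ × Fin k => a p.1 p.2)) ↔ IsIndiscernible L ∅ a

variable (L) in
/-- The Lascar strong type of `a` over `B` is `C`-Ls-invariant: for all small tuples `b`, `b'`
in `B` with `b ≡^Ls_C b'` we have `ab ≡^Ls_C ab'`. -/
def LsInvariantOver (κ : Cardinal.{w}) (C B : Set M) (a : X → M) : Prop :=
  ∀ Y : Type w, #Y < κ → ∀ b b' : Y → M, range b ⊆ B → range b' ⊆ B →
    LsEquiv L C b b' → LsEquiv L C (Sum.elim a b) (Sum.elim a b')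

end Types

/-! ### Global types -/

variable (L) in
/-- A set of positive formulas over `M` in the variables `X` that is finitely satisfiable in `M`. -/
structure IsGlobalPartialType (M : Type w) [L.Structure M] (X : Type x)
    (S : Set (L.Formula (M ⊕ X))) : Prop where
  positive : ∀ φ ∈ S, IsPositive φ
  finSat : ∀ F : Finset (L.Formula (M ⊕ X)), ↑F ⊆ S →
    ∃ a : X → M, ∀ φ ∈ F, φ.Realize (Sum.elim id a)

variable (L) in
/-- A global type: a maximal consistent set of positive formulas over the monster `M`.
(As `M` is e.c., consistency is the same as finite satisfiability in `M`.) -/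
structure GlobalType (M : Type w) [L.Structure M] (X : Type x) where
  formulas : Set (L.Formula (M ⊕ X))
  isPartialType : IsGlobalPartialType L M X formulas
  maximal : ∀ S, IsGlobalPartialType L M X S → formulas ⊆ S → S = formulas

namespace GlobalType

variable {M N : Type w} [L.Structure M] [L.Structure N] {X : Type x}

/-- The tuple `α` in the bigger monster `N` realises `q`. -/
def IsRealizedBy (q : GlobalType L M X) (ι : M →[L] N) (α : X → N) : Prop :=
  ∀ φ ∈ q.formulas, φ.Realize (Sum.elim ι α)

/-- `q` extends `tp(a/B)`. -/
def ExtendsTypeOf (q : GlobalType L M X) (a : X → M) (B : Set M) : Prop :=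
  ∀ φ : L.Formula (B ⊕ X), IsPositive φ → φ.Realize (Sum.elim Subtype.val a) →
    φ.relabel (Sum.map Subtype.val id) ∈ q.formulas

/-- `q` is `C`-Ls-invariant: for `α ⊨ q` and small tuples `b`, `b'` in `M` with
`b ≡^Ls_C b'` we have `αb ≡^Ls_C αb'`. Realisations live in the bigger monster `N`. -/
def IsLsInvariant (κ : Cardinal.{w}) (ι : M →[L] N) (C : Set M) (q : GlobalType L M X) : Prop :=
  ∀ α : X → N, q.IsRealizedBy ι α → LsInvariantOver L κ (ι '' C) (range ι) α

/-- `(α_i)_{i < ω} ⊨ q^{⊗ω}` for a `C`-Ls-invariant `q`: each `α_i` realises the (unique)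
`C`-Ls-invariant extension of `q` to `M ∪ {α_j : j < i}`. -/
def TensorPowerRealizedBy (κ : Cardinal.{w}) (ι : M →[L] N) (C : Set M) (q : GlobalType L M X)
    (α : ℕ → X → N) : Prop :=
  ∀ i : ℕ, q.IsRealizedBy ι (α i) ∧
    LsInvariantOver L κ (ι '' C) (range ι ∪ {e | ∃ j < i, e ∈ range (α j)}) (α i)

/-- `(a_i)_{i < ω}` is a Morley sequence in `q` over `C`: `(a_i) ≡^Ls_C (α_i)` for some
`(α_i) ⊨ q^{⊗ω}`. -/
def IsMorleySequence (κ : Cardinal.{w}) (ι : M →[L] N) (C : Set M) (q : GlobalType L M X)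
    (a : ℕ → X → M) : Prop :=
  ∃ α : ℕ → X → N, q.TensorPowerRealizedBy κ ι C α ∧
    LsEquiv L (ι '' C) (fun p : ℕ × X => ι (a p.1 p.2)) (fun p : ℕ × X => α p.1 p.2)

end GlobalType

/-- `a ⫫^{iLs}_C B`: the type `tp(a/CB)` extends to a global `C`-Ls-invariant type. -/
def ILsIndep {M N : Type w} [L.Structure M] [L.Structure N] {X : Type x} (κ : Cardinal.{w})
    (ι : M →[L] N) (C : Set M) (a : X → M) (B : Set M) : Prop :=
  ∃ q : GlobalType L M X, q.ExtendsTypeOf a (C ∪ B) ∧ q.IsLsInvariant κ ι C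

end PosLogic

open PosLogic

/-!
Everything is reduced to types over `C`, by means of two facts about Lascar strong types.

* A tuple `α` has `C`-Ls-invariant Lascar strong type over a monster model exactly when every
  `C`-indiscernible sequence `(t_i)` of the model gives a `C`-indiscernible sequence `(α t_i)`
  (`PreservesIndiscernibles`). Indeed finite increasing subtuples of `(t_i)` have the same Lascar
  strong type over `C`, being at distance at most one from a subtuple far to the right. By
  thickness, the condition on `α` is expressed by positive formulas, so it passes to limits.
* Whether `d_C(a, b) ≤ n` depends only on the type of `(a, b)` over `C`.

Each `tp(a_n / C a_{<n})` extends to a `C`-Ls-invariant global type, so compactness gives one tuple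
`β` of the bigger monster model that preserves the indiscernible sequences of `M` and satisfies
`β ≡ a_n` over `C a_{<n}` for every `n` (`exists_continuation`). The required type is
`q = tp(β / M)`. Since a small part of the bigger model can be reflected into `M`, compactness also
shows that `q` has a realisation with `C`-Ls-invariant Lascar strong type over any small set
(`PreservesIndiscernibles.exists_lsInvariantOver`), and iterating this produces `(α_i) ⊨ q^{⊗ω}`.

By induction on `k`, the sequence `a_{<n}, α_0, …, α_{k-1}` has the type of `a_{<n+k}` over `C`
(`posEquiv_append`), so that `(a_i)` followed by `(α_i)` is `C`-indiscernible of order type `ω + ω`.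
Stretching this to order type `ω · ω` and cutting into blocks of length `ω` shows that `(a_i)` and
`(α_i)` are at Lascar distance at most one over `C`.

The compactness arguments rest on the maximality of positive types in existentially closed models
(`IsECModel.posEquiv_of_posLE`), which turns an inclusion of types into an equality.
-/

namespace PosLogic

open FirstOrder.Language

/-! ### Positive formulas: renaming, finite support and existential closure -/

section PositiveFormulas

variable {L : FirstOrder.Language.{u, v}} {α : Type*} {β : Type*}

theorem IsPositive.bRelabel {k : ℕ} {φ : L.BoundedFormula α k} (h : IsPositive φ) {n : ℕ}
    (g : α → β ⊕ Fin n) : IsPositive (φ.relabel g) := by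
  induction h with
  | bot => exact .bot
  | top => exact .top
  | equal t₁ t₂ => exact .equal _ _
  | rel R ts => exact .rel _ _
  | inf _ _ ih₁ ih₂ => exact .inf ih₁ ih₂
  | sup _ _ ih₁ ih₂ => exact .sup ih₁ ih₂
  | ex _ ih => rw [BoundedFormula.relabel_ex]; exact .ex ih

theorem IsPositive.relabel {φ : L.Formula α} (h : IsPositive φ) (g : α → β) :
    IsPositive (φ.relabel g) :=
  IsPositive.bRelabel (n := 0) h _

theorem IsPositive.exs : ∀ {n : ℕ} {φ : L.BoundedFormula α n}, IsPositive φ → IsPositive φ.exs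
  | 0, _, h => h
  | _ + 1, φ, h => IsPositive.exs (φ := φ.ex) (.ex h)

theorem IsPositive.restrictFreeVar [DecidableEq α] {n : ℕ} {φ : L.BoundedFormula α n}
    (h : IsPositive φ) (f : φ.freeVarFinset → β) : IsPositive (φ.restrictFreeVar f) := by
  induction h with
  | bot => exact .bot
  | top => exact .top
  | equal t₁ t₂ => exact .equal _ _
  | rel R ts => exact .rel _ _
  | inf _ _ ih₁ ih₂ => exact .inf (ih₁ _) (ih₂ _)
  | sup _ _ ih₁ ih₂ => exact .sup (ih₁ _) (ih₂ _)
  | ex _ ih => exact .ex (ih _)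

/-- A positive formula involves only finitely many variables. -/
theorem IsPositive.exists_fin {φ : L.Formula α} (h : IsPositive φ) :
    ∃ (n : ℕ) (g : Fin n → α) (ψ : L.Formula (Fin n)), IsPositive ψ ∧
      ∀ (M : Type w) [L.Structure M] (v : α → M), φ.Realize v ↔ ψ.Realize (v ∘ g) := by
  classical
  let e := φ.freeVarFinset.equivFin
  refine ⟨_, fun i => (e.symm i : α), BoundedFormula.restrictFreeVar φ e,
    h.restrictFreeVar _, fun M _ v => ?_⟩
  exact (BoundedFormula.realize_restrictFreeVar v (by simp)).symm

/-- Existential closure: a finite set of positive formulas in the variables `α ⊕ β` can be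
realised over a given interpretation of `α` exactly when a positive formula in `α` holds. -/
theorem exists_positive_iff_exists_realize (F : Finset (L.Formula (α ⊕ β)))
    (hF : ∀ φ ∈ F, IsPositive φ) :
    ∃ ψ : L.Formula α, IsPositive ψ ∧ ∀ (M : Type w) [L.Structure M] [Nonempty M] (a : α → M),
      ψ.Realize a ↔ ∃ b : β → M, ∀ φ ∈ F, φ.Realize (Sum.elim a b) := by
  classical
  obtain ⟨θ, hθ, hθF⟩ : ∃ θ : L.Formula (α ⊕ β), IsPositive θ ∧
      ∀ (M : Type w) [L.Structure M] (v : α ⊕ β → M), θ.Realize v ↔ ∀ φ ∈ F, φ.Realize v := by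
    induction F using Finset.induction_on with
    | empty => exact ⟨⊤, .top, fun M _ v => by simp⟩
    | insert φ F _ ih =>
      obtain ⟨θ, hθ, h⟩ := ih fun φ hφ => hF φ (Finset.mem_insert_of_mem hφ)
      refine ⟨φ ⊓ θ, .inf (hF φ (Finset.mem_insert_self _ _)) hθ, fun M _ v => ?_⟩
      simp [h]
  obtain ⟨n, g, χ, hχ, hχθ⟩ := IsPositive.exists_fin.{u, v, w} hθ
  -- Only the variables of `β` listed by `g` have to be quantified.
  let B : Set β := {b | Sum.inr b ∈ range g}
  have : Finite B := ((finite_range g).preimage Sum.inr_injective.injOn).to_subtype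
  have hg : ∀ i, ∃ x : α ⊕ B, Sum.map id Subtype.val x = g i := fun i => by
    rcases hx : g i with x | x
    · exact ⟨.inl x, rfl⟩
    · exact ⟨.inr ⟨x, i, hx⟩, rfl⟩
  choose g' hg' using hg
  refine ⟨(χ.relabel g').iExs B, IsPositive.exs ((hχ.relabel g').bRelabel _),
    fun M _ _ a => ?_⟩
  simp only [Formula.realize_iExs, Formula.realize_relabel, ← hθF]
  simp only [hχθ M]
  have key : ∀ b : β → M, Sum.elim a b ∘ g = Sum.elim a (b ∘ Subtype.val) ∘ g' := by
    intro b
    funext i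
    rw [Function.comp_apply, ← hg' i, Function.comp_apply]
    rcases g' i with x | x <;> rfl
  constructor
  · rintro ⟨b, hb⟩
    refine ⟨fun y => if h : y ∈ B then b ⟨y, h⟩ else Classical.arbitrary M, ?_⟩
    rw [key]
    convert! hb using 3
    funext y
    simp
  · rintro ⟨b, hb⟩
    exact ⟨b ∘ Subtype.val, by rwa [← key]⟩

end PositiveFormulas

/-! ### Comparing the positive types of two tuples -/

section PosEquiv

variable {L : FirstOrder.Language.{u, v}} {M N P : Type w} [L.Structure M] [L.Structure N]
  [L.Structure P] {X Y Z : Type*}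

variable (L) in
/-- Every positive formula true of the tuple `a` is true of the tuple `b`; the tuples may live in
different structures. -/
def PosLE (a : X → M) (b : X → N) : Prop :=
  ∀ φ : L.Formula X, IsPositive φ → φ.Realize a → φ.Realize b

variable (L) in
/-- The tuples `a` and `b`, possibly in different structures, have the same positive type. Types
over parameters are expressed by adjoining the parameters to the tuples. -/
def PosEquiv (a : X → M) (b : X → N) : Prop :=
  ∀ φ : L.Formula X, IsPositive φ → (φ.Realize a ↔ φ.Realize b)

theorem PosEquiv.refl (a : X → M) : PosEquiv L a a := fun _ _ => Iff.rfl

theorem PosEquiv.symm {a : X → M} {b : X → N} (h : PosEquiv L a b) : PosEquiv L b a :=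
  fun φ hφ => (h φ hφ).symm

theorem PosEquiv.trans {a : X → M} {b : X → N} {c : X → P} (h : PosEquiv L a b)
    (h' : PosEquiv L b c) : PosEquiv L a c := fun φ hφ => (h φ hφ).trans (h' φ hφ)

theorem PosEquiv.posLE {a : X → M} {b : X → N} (h : PosEquiv L a b) : PosLE L a b :=
  fun φ hφ => (h φ hφ).1

theorem PosEquiv.comp {a : X → M} {b : X → N} (h : PosEquiv L a b) (f : Y → X) :
    PosEquiv L (a ∘ f) (b ∘ f) := fun φ hφ => by
  have := h (φ.relabel f) (hφ.relabel f)
  simpa only [Formula.realize_relabel] using this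

/-- Tuples of the same type still have the same type after reindexing along a common map. -/
theorem PosEquiv.reindex {a : X → M} {b : X → N} (h : PosEquiv L a b) (f : Y → X)
    {a' : Y → M} {b' : Y → N} (ha : ∀ y, a' y = a (f y)) (hb : ∀ y, b' y = b (f y)) :
    PosEquiv L a' b' := by
  obtain rfl : a' = a ∘ f := funext ha
  obtain rfl : b' = b ∘ f := funext hb
  exact h.comp f

theorem PosLE.eq_of_eq {a : X → M} {b : X → N} (h : PosLE L a b) {x y : X} (hxy : a x = a y) :
    b x = b y := by
  have := h ((Term.var x).equal (Term.var y)) (.equal _ _)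
  simp only [Formula.realize_equal, Term.realize_var] at this
  exact this hxy

theorem PosEquiv.eq_iff {a : X → M} {b : X → N} (h : PosEquiv L a b) {x y : X} :
    a x = a y ↔ b x = b y := ⟨h.posLE.eq_of_eq, h.symm.posLE.eq_of_eq⟩

/-- Positive types are determined by their restrictions to finite subtuples. -/
theorem posEquiv_of_fin {a : X → M} {b : X → N}
    (h : ∀ (n : ℕ) (f : Fin n → X), PosEquiv L (a ∘ f) (b ∘ f)) : PosEquiv L a b := by
  intro φ hφ
  obtain ⟨n, g, ψ, hψ, hφψ⟩ := IsPositive.exists_fin.{u, v, w} hφ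
  rw [hφψ M, hφψ N]
  exact h n g ψ hψ

theorem posEquiv_equiv (e : M ≃[L] M) (a : X → M) : PosEquiv L (e ∘ a) a := fun φ _ =>
  StrongHomClass.realize_formula e φ

end PosEquiv

/-! ### Maximality of positive types in existentially closed models -/

section Maximality

variable {L : FirstOrder.Language.{u, v}} {T : L.Theory}

theorem IsImmersion.posEquiv {M N : Type w} [L.Structure M] [L.Structure N] {f : M →[L] N}
    (hf : IsImmersion f) {X : Type*} (a : X → M) : PosEquiv L (f ∘ a) a :=
  posEquiv_of_fin fun n g φ hφ => hf n φ hφ (a ∘ g)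

theorem IsImmersion.injective {M N : Type w} [L.Structure M] [L.Structure N] {f : M →[L] N}
    (hf : IsImmersion f) : Function.Injective f := fun x y h =>
  ((hf.posEquiv (id : M → M)).eq_iff (x := x) (y := y)).1 h

/-- If the positive type of `a` is contained in that of `b`, then every finite part of the
positive diagram of the whole structure can be realised in a way that sends `a` to `b`. -/
theorem PosLE.exists_realize_finset {N : Type w} [L.Structure N] [Nonempty N] {X : Type*}
    {a b : X → N} (h : PosLE L a b) (F : Finset (L.Formula N))
    (hF : ∀ φ ∈ F, IsPositive φ ∧ φ.Realize id) :
    ∃ g : N → N, g ∘ a = b ∧ ∀ φ ∈ F, φ.Realize g := by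
  classical
  let s : N → X ⊕ N := fun m => if hm : ∃ x, a x = m then .inl hm.choose else .inr m
  have hs : Sum.elim a id ∘ s = id := by
    funext m
    by_cases hm : ∃ x, a x = m
    · simp only [Function.comp_apply, s, dif_pos hm, Sum.elim_inl, id, hm.choose_spec]
    · simp only [Function.comp_apply, s, dif_neg hm, Sum.elim_inr, id]
  obtain ⟨ψ, hψ, hψF⟩ := exists_positive_iff_exists_realize.{u, v, w}
    (F.image fun φ => φ.relabel s) (by
      intro φ hφ
      obtain ⟨φ', hφ', rfl⟩ := Finset.mem_image.1 hφ
      exact (hF φ' hφ').1.relabel s)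
  simp only [Finset.forall_mem_image, Formula.realize_relabel] at hψF
  obtain ⟨d, hd⟩ := (hψF N b).1 (h ψ hψ ((hψF N a).2 ⟨id, fun φ hφ => by
    rw [hs]; exact (hF φ hφ).2⟩))
  refine ⟨Sum.elim b d ∘ s, ?_, fun φ hφ => hd hφ⟩
  funext x
  have hx : ∃ y, a y = a x := ⟨x, rfl⟩
  simp only [Function.comp_apply, s, dif_pos hx, Sum.elim_inl]
  exact h.eq_of_eq hx.choose_spec

/-- In an existentially closed model, positive types are maximal. Were `tp(a)` properly contained
in `tp(b)`, an ultrapower of the model would admit a homomorphism from the model sending `a` to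
the diagonal copy of `b`, and this homomorphism could not be an immersion. -/
theorem IsECModel.posEquiv_of_posLE {N : Type w} [L.Structure N] [Nonempty N]
    [Small.{w} (L.Formula N)] (hN : IsECModel T N) {X : Type*} {a b : X → N} (h : PosLE L a b) :
    PosEquiv L a b := by
  classical
  let Φ := {φ : L.Formula N // IsPositive φ ∧ φ.Realize id}
  let I := Finset (Shrink.{w} Φ)
  let sh : Φ ≃ Shrink.{w} Φ := equivShrink Φ
  have hg : ∀ i : I, ∃ g : N → N, g ∘ a = b ∧ ∀ φ : Φ, sh φ ∈ i → φ.1.Realize g := by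
    intro i
    obtain ⟨g, hg, hg'⟩ := h.exists_realize_finset (i.image fun p => (sh.symm p).1) (by
      intro φ hφ
      obtain ⟨p, _, rfl⟩ := Finset.mem_image.1 hφ
      exact (sh.symm p).2)
    exact ⟨g, hg, fun φ hφ => hg' _ (Finset.mem_image.2 ⟨_, hφ, by simp⟩)⟩
  choose g hga hg using hg
  let U : Ultrafilter I := Ultrafilter.of Filter.atTop
  have hU : ∀ φ : Φ, ∀ᶠ i in (U : Filter I), φ.1.Realize (g i) := by
    intro φ
    have : ∀ᶠ i : I in Filter.atTop, sh φ ∈ i :=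
      Filter.eventually_atTop.2 ⟨{sh φ}, fun i hi => hi (Finset.mem_singleton_self _)⟩
    exact (this.mono fun i hi => hg i φ hi).filter_mono (Ultrafilter.of_le _)
  let Q := (U : Filter I).Product fun _ => N
  let c : (I → N) → Q := fun x => (x : (U : Filter I).Product fun _ => N)
  have hc : ∀ x y : I → N, (∀ᶠ i in (U : Filter I), x i = y i) → c x = c y := fun x y hxy =>
    Quotient.sound' hxy
  let f : N →[L] Q :=
    { toFun := fun m => c fun i => g i m
      map_fun' := by
        intro n F m
        refine Eq.trans (hc _ _ ?_) (Ultraproduct.funMap_cast F fun j i => g i (m j)).symm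
        have := hU ⟨(Term.var (Structure.funMap F m)).equal (.func F fun j => .var (m j)),
          .equal _ _, by simp [Term.realize]⟩
        simpa [Term.realize] using this
      map_rel' := by
        intro n R m hR
        have := hU ⟨R.formula fun j => .var (m j), .rel _ _, by
          simpa [Formula.realize_rel] using hR⟩
        have h' := (Ultraproduct.realize_formula_cast (u := U) (M := fun _ : I => N)
          (R.formula fun j => .var (m j)) fun m i => g i m).2 this
        exact Formula.realize_rel.1 h' }
  have hQ : Q ⊨ T := by
    refine ⟨fun σ hσ => ?_⟩
    exact (Ultraproduct.sentence_realize σ).2 (Filter.Eventually.of_forall fun _ =>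
      hN.models.realize_of_mem σ hσ)
  have hf := (hN.immersion Q hQ f).posEquiv a
  intro φ hφ
  refine ⟨h φ hφ, fun hb => (hf φ hφ).1 ?_⟩
  have hfa : f ∘ a = fun x => c fun _ => b x := by
    funext x
    exact hc _ _ (Filter.Eventually.of_forall fun i => congrFun (hga i) x)
  rw [hfa]
  exact (Ultraproduct.realize_formula_cast φ fun x _ => b x).2
    (Filter.Eventually.of_forall fun _ => hb)

theorem IsMonster.aleph0_lt {κ : Cardinal.{w}} {M : Type w} [L.Structure M]
    (hM : IsMonster T κ M) : ℵ₀ < κ := by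
  have h0 : (0 : Cardinal.{w}) < κ := by
    rcases eq_or_ne κ 0 with rfl | h
    · have := hM.card_language
      simp at this
    · exact pos_iff_ne_zero.2 h
  exact (aleph0_le_beth _).trans_lt (hM.beth_lt 0 h0)

theorem IsMonster.two_power_lt {κ : Cardinal.{w}} {M : Type w} [L.Structure M]
    (hM : IsMonster T κ M) {μ : Cardinal.{w}} (h : μ < κ) : 2 ^ μ < κ :=
  ((Order.le_succ _).trans (le_beth_ord _)).trans_lt (hM.beth_lt μ h)

theorem IsMonster.small_formula {κ : Cardinal.{w}} {M : Type w} [L.Structure M]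
    (hM : IsMonster T κ M) (A : Type w) : Small.{w} (L.Formula A) := by
  obtain ⟨c, hc⟩ := mem_range_lift_of_le hM.card_language.le
  let B := (max ℵ₀ (#A + c)).out
  have hB : #(Σ n, L.BoundedFormula A n) ≤ #(ULift.{max u v} B) := by
    refine BoundedFormula.card_le.trans (le_of_eq ?_)
    rw [← hc, mk_uLift, mk_out, lift_max, lift_aleph0, lift_add]
  obtain ⟨e⟩ := hB
  exact small_of_injective (β := ULift.{max u v} B) (f := fun φ : L.Formula A => e ⟨0, φ⟩)
    fun φ ψ h => by simpa using e.injective h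

end Maximality

/-! ### Compactness in a monster model -/

section Compactness

variable {L : FirstOrder.Language.{u, v}} {T : L.Theory} {κ κ' : Cardinal.{w}}
  {M N : Type w} [L.Structure M] [L.Structure N]

theorem IsMonster.posEquiv_of_posLE [Nonempty N] (hN : IsMonster T κ N) {X : Type*} {a b : X → N}
    (h : PosLE L a b) : PosEquiv L a b :=
  haveI := hN.small_formula N
  hN.ec.posEquiv_of_posLE h

theorem IsMonster.isImmersion (hM : IsMonster T κ M) (hN : IsMonster T κ' N) (ι : M →[L] N) :
    IsImmersion ι :=
  hM.ec.immersion N hN.ec.models ι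

/-- Compactness in forcing form: given a directed family of satisfiable conditions on a small
tuple, some tuple satisfies every positive formula, with parameters in a small tuple `d`, that is
implied by one of the conditions. -/
theorem IsMonster.exists_realize_forced (hN : IsMonster T κ N) {A V : Type w} (hA : #A < κ)
    (hV : #V < κ) (d : A → N) {I : Type*} [Nonempty I] (P : I → (V → N) → Prop)
    (hdir : ∀ i j, ∃ k, ∀ β, P k β → P i β ∧ P j β) (hsat : ∀ i, ∃ β, P i β) :
    ∃ β : V → N, ∀ i (φ : L.Formula (A ⊕ V)), IsPositive φ →
      (∀ γ, P i γ → φ.Realize (Sum.elim d γ)) → φ.Realize (Sum.elim d β) := by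
  classical
  have hB : #(range d) < κ := mk_range_le.trans_lt hA
  have hr : ∀ (φ : L.Formula (A ⊕ V)) (γ : V → N),
      (φ.relabel (Sum.map (rangeFactorization d) id)).Realize
        (Sum.elim (Subtype.val : range d → N) γ) ↔ φ.Realize (Sum.elim d γ) := by
    intro φ γ
    rw [Formula.realize_relabel, Sum.elim_comp_map]
    rfl
  obtain ⟨β, hβ⟩ := hN.saturated (range d) V hB hV
    {φ | IsPositive φ ∧ ∃ i, ∀ γ, P i γ → φ.Realize (Sum.elim Subtype.val γ)}
    (fun φ hφ => hφ.1) (by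
      intro F hF
      have : ∃ i, ∀ φ ∈ F, ∀ γ, P i γ → φ.Realize (Sum.elim Subtype.val γ) := by
        induction F using Finset.induction_on with
        | empty => exact ⟨Classical.arbitrary I, by simp⟩
        | insert φ F _ ih =>
          obtain ⟨i, hi⟩ := ih fun ψ hψ => hF (Finset.mem_insert_of_mem hψ)
          obtain ⟨j, hj⟩ := (hF (Finset.mem_insert_self φ F)).2
          obtain ⟨k, hk⟩ := hdir i j
          refine ⟨k, fun ψ hψ γ hγ => ?_⟩
          rcases Finset.mem_insert.1 hψ with rfl | hψ
          · exact hj γ (hk γ hγ).2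
          · exact hi ψ hψ γ (hk γ hγ).1
      obtain ⟨i, hi⟩ := this
      obtain ⟨γ, hγ⟩ := hsat i
      exact ⟨γ, fun φ hφ => hi φ hφ γ hγ⟩)
  exact ⟨β, fun i φ hφ h => (hr φ β).1
    (hβ _ ⟨hφ.relabel _, i, fun γ hγ => (hr φ γ).2 (h γ hγ)⟩)⟩

/-- Types can be extended along an inclusion of types: if `tp(a) ⊆ tp(b)`, any small tuple `c`
next to `a` has a counterpart next to `b`. -/
theorem IsMonster.exists_posLE_extension [Nonempty M] [Nonempty N] (hN : IsMonster T κ N)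
    {A V : Type w} (hA : #A < κ) (hV : #V < κ) {a : A → M} {b : A → N} (h : PosLE L a b)
    (c : V → M) :
    ∃ d : V → N, PosLE L (Sum.elim a c) (Sum.elim b d) := by
  classical
  obtain ⟨d, hd⟩ := hN.exists_realize_forced hA hV b
    (I := Finset {φ : L.Formula (A ⊕ V) // IsPositive φ ∧ φ.Realize (Sum.elim a c)})
    (fun F γ => ∀ φ ∈ F, φ.1.Realize (Sum.elim b γ))
    (fun F G => ⟨F ∪ G, fun γ hγ => ⟨fun φ hφ => hγ φ (Finset.mem_union_left _ hφ),
      fun φ hφ => hγ φ (Finset.mem_union_right _ hφ)⟩⟩)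
    (by
      intro F
      obtain ⟨ψ, hψ, hψF⟩ := exists_positive_iff_exists_realize.{u, v, w} (F.image Subtype.val)
        (by
          intro φ hφ
          obtain ⟨φ, _, rfl⟩ := Finset.mem_image.1 hφ
          exact φ.2.1)
      simp only [Finset.forall_mem_image] at hψF
      obtain ⟨γ, hγ⟩ := (hψF N b).1 (h ψ hψ ((hψF M a).2 ⟨c, fun φ _ => φ.2.2⟩))
      exact ⟨γ, fun φ hφ => hγ hφ⟩)
  exact ⟨d, fun φ hφ hac => hd {⟨φ, hφ, hac⟩} φ hφ fun γ hγ => hγ _ (Finset.mem_singleton_self _)⟩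

theorem IsMonster.exists_extension [Nonempty N] (hN : IsMonster T κ N) {A V : Type w}
    (hA : #A < κ) (hV : #V < κ) {a b : A → N} (h : PosEquiv L a b) (c : V → N) :
    ∃ d : V → N, PosEquiv L (Sum.elim a c) (Sum.elim b d) :=
  (hN.exists_posLE_extension hA hV h.posLE c).imp fun _ hd => hN.posEquiv_of_posLE hd

/-- Reflection: over a small tuple of `M`, every small tuple of the bigger monster model has the
same type as one in `M`. -/
theorem IsMonster.exists_reflection [Nonempty M] [Nonempty N] (hM : IsMonster T κ M)
    (hN : IsMonster T κ' N) (ι : M →[L] N) {A V : Type w} (hA : #A < κ) (hV : #V < κ)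
    (a : A → M) (c : V → N) :
    ∃ d : V → M, PosEquiv L (Sum.elim (ι ∘ a) c) (Sum.elim (ι ∘ a) (ι ∘ d)) := by
  have hι := hM.isImmersion hN ι
  obtain ⟨d, hd⟩ := hM.exists_posLE_extension hA hV (hι.posEquiv a).posLE c
  refine ⟨d, hN.posEquiv_of_posLE fun φ hφ h => ?_⟩
  have := (hι.posEquiv (Sum.elim a d) φ hφ).2 (hd φ hφ h)
  rwa [Sum.comp_elim] at this

theorem IsMonster.exists_equiv (hN : IsMonster T κ N) {A : Type w} (hA : #A < κ) {a b : A → N}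
    (h : PosEquiv L a b) : ∃ f : N ≃[L] N, f ∘ a = b :=
  (hN.homogeneous A hA a b h).imp fun _ hf => funext hf

theorem IsMonster.sum_lt (hN : IsMonster T κ N) {A B : Type w} (hA : #A < κ) (hB : #B < κ) :
    #(A ⊕ B) < κ := by
  rw [mk_sum, lift_id, lift_id]
  exact add_lt_of_lt hN.aleph0_lt.le hA hB

theorem IsMonster.prod_lt (hN : IsMonster T κ N) {A B : Type w} (hA : #A < κ) (hB : #B < κ) :
    #(A × B) < κ := by
  rw [mk_prod, lift_id, lift_id]
  exact mul_lt_of_lt hN.aleph0_lt.le hA hB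

theorem IsMonster.countable_prod_lt (hN : IsMonster T κ N) {J : Type} [Countable J] {B : Type w}
    (hB : #B < κ) : #(J × B) < κ := by
  rw [mk_prod]
  refine mul_lt_of_lt hN.aleph0_lt.le ?_ (by rwa [lift_uzero])
  exact (lift_le_aleph0.2 (mk_le_aleph0 (α := J))).trans_lt hN.aleph0_lt

end Compactness

/-! ### Indiscernible sequences and Lascar distance -/

section Indiscernible

variable {L : FirstOrder.Language.{u, v}} {M N : Type w} [L.Structure M] [L.Structure N]
  {I : Type*} {X : Type*}

variable (L) in
/-- The sequences `e` and `e'`, indexed by linear orders, have the same Ehrenfeucht–Mostowski type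
over the tuples `c` and `c'` respectively: any two finite increasing subsequences of the same
length, one of `e` and one of `e'`, have the same type. Thus a sequence is indiscernible when it
is related to itself. -/
def SameEM {Λ Λ' : Type*} [LinearOrder Λ] [LinearOrder Λ'] (c : I → M) (e : Λ → X → M)
    (c' : I → N) (e' : Λ' → X → N) : Prop :=
  ∀ (n : ℕ) (f : Fin n → Λ) (g : Fin n → Λ'), StrictMono f → StrictMono g →
    PosEquiv L (Sum.elim c fun p : Fin n × X => e (f p.1) p.2)
      (Sum.elim c' fun p : Fin n × X => e' (g p.1) p.2)

theorem SameEM.trans_indisc {Λ Λ' : Type*} [LinearOrder Λ] [LinearOrder Λ'] {c : I → M}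
    {a : ℕ → X → M} {e : Λ → X → M} {e' : Λ' → X → M} (h : SameEM L c e c a)
    (h' : SameEM L c e' c a) : SameEM L c e c e' := fun n f g hf hg =>
  (h n f (fun i => i) hf (fun _ _ h => h)).trans (h' n g (fun i => i) hg (fun _ _ h => h)).symm

/-- Arbitrary subfamilies of the same order type, possibly infinite and with repetitions, of two
sequences with the same Ehrenfeucht–Mostowski type have the same type. -/
theorem SameEM.posEquiv {Λ Λ' : Type*} [LinearOrder Λ] [LinearOrder Λ'] {c : I → M}
    {e : Λ → X → M} {c' : I → N} {e' : Λ' → X → N} (h : SameEM L c e c' e') {J : Type*}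
    {f : J → Λ} {g : J → Λ'} (hfg : ∀ x y, f x < f y ↔ g x < g y) :
    PosEquiv L (Sum.elim c fun p : J × X => e (f p.1) p.2)
      (Sum.elim c' fun p : J × X => e' (g p.1) p.2) := by
  classical
  refine posEquiv_of_fin fun n k => ?_
  -- The finitely many indices that occur, and an increasing enumeration of their images.
  let s : Finset J := Finset.univ.biUnion fun i => Sum.elim (fun _ => ∅) (fun p => {p.1}) (k i)
  have hs : ∀ i p, k i = Sum.inr p → p.1 ∈ s := fun i p hp =>
    Finset.mem_biUnion.2 ⟨i, Finset.mem_univ _, by simp [hp]⟩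
  let t := s.image f
  let r := t.orderEmbOfFin rfl
  have hr : ∀ j ∈ s, ∃ i, r i = f j := fun j hj => by
    have : f j ∈ range r := by
      rw [Finset.range_orderEmbOfFin]
      exact Finset.mem_coe.2 (Finset.mem_image_of_mem f hj)
    exact this
  have hr' : ∀ i, ∃ j ∈ s, f j = r i := fun i =>
    Finset.mem_image.1 (t.orderEmbOfFin_mem rfl i)
  choose σ hσs hσ using hr'
  have hgr : StrictMono (g ∘ σ) := fun i i' hi => by
    rw [Function.comp_apply, Function.comp_apply, ← hfg, hσ, hσ]
    exact r.strictMono hi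
  have hgeq : ∀ x y, f x = f y → g x = g y := fun x y hxy =>
    le_antisymm (not_lt.1 fun hlt => ((hfg y x).2 hlt).ne hxy.symm)
      (not_lt.1 fun hlt => ((hfg x y).2 hlt).ne hxy)
  have hk : ∀ i, ∃ q : I ⊕ Fin t.card × X,
      Sum.elim c (fun p : J × X => e (f p.1) p.2) (k i) =
        Sum.elim c (fun p : Fin t.card × X => e (r p.1) p.2) q ∧
      Sum.elim c' (fun p : J × X => e' (g p.1) p.2) (k i) =
        Sum.elim c' (fun p : Fin t.card × X => e' ((g ∘ σ) p.1) p.2) q := by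
    intro i
    rcases hki : k i with x | p
    · exact ⟨.inl x, rfl, rfl⟩
    · obtain ⟨m, hm⟩ := hr p.1 (hs i p hki)
      refine ⟨.inr (m, p.2), ?_, ?_⟩
      · simp only [Sum.elim_inr, hm]
      · simp only [Sum.elim_inr, Function.comp_apply]
        rw [hgeq p.1 (σ m) (hm.symm.trans (hσ m).symm)]
  choose q hq hq' using hk
  exact (h _ r (g ∘ σ) r.strictMono hgr).reindex q hq hq'

end Indiscernible

section Lascar

variable {L : FirstOrder.Language.{u, v}} {M N : Type w} [L.Structure M] [L.Structure N]
  {I : Type*} {X Y : Type*}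

/-- In `SameType` the parameter set may be replaced by any tuple enumerating it. -/
theorem sameType_iff_of_range_eq {C : Set M} {c : I → M} (hc : range c = C) {u v : X → M} :
    SameType L C u v ↔ PosEquiv L (Sum.elim c u) (Sum.elim c v) := by
  subst hc
  constructor
  · intro h
    have h' : PosEquiv L (Sum.elim (Subtype.val : range c → M) u) (Sum.elim Subtype.val v) := h
    exact h'.reindex (Sum.map (rangeFactorization c) id)
      (by rintro (i | x) <;> rfl) (by rintro (i | x) <;> rfl)
  · intro h
    have hs : ∀ m : range c, ∃ i, c i = m := fun m => m.2
    choose s hs using hs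
    exact PosEquiv.reindex (a' := Sum.elim (Subtype.val : range c → M) u)
      (b' := Sum.elim Subtype.val v) h (Sum.map s id)
      (by rintro (i | x) <;> simp [hs]) (by rintro (i | x) <;> simp [hs])

theorem isIndiscernible_iff_of_range_eq {C : Set M} {c : I → M} (hc : range c = C)
    {a : ℕ → X → M} : IsIndiscernible L C a ↔ SameEM L c a c a :=
  forall_congr' fun _ => forall₄_congr fun _ _ _ _ => sameType_iff_of_range_eq hc

theorem SameEM.transfer {c : I → M} {a : ℕ → X → M} (h : SameEM L c a c a)
    {c' : I → N} {a' : ℕ → X → N}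
    (h' : PosEquiv L (Sum.elim c fun p : ℕ × X => a p.1 p.2)
      (Sum.elim c' fun p : ℕ × X => a' p.1 p.2)) : SameEM L c' a' c' a' := by
  intro n f g hf hg
  have key : ∀ f : Fin n → ℕ, PosEquiv L (Sum.elim c fun p : Fin n × X => a (f p.1) p.2)
      (Sum.elim c' fun p : Fin n × X => a' (f p.1) p.2) := fun f =>
    h'.reindex (Sum.map id (Prod.map f id)) (by rintro (i | x) <;> rfl)
      (by rintro (i | x) <;> rfl)
  exact (key f).symm.trans ((h n f g hf hg).trans (key g))

theorem SameEM.comp {Λ Λ' : Type*} [LinearOrder Λ] [LinearOrder Λ'] {c : I → M} {e : Λ → X → M}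
    {c' : I → N} {e' : Λ' → X → N} (h : SameEM L c e c' e') (k : Y → X) :
    SameEM L c (fun i => e i ∘ k) c' fun i => e' i ∘ k := fun n f g hf hg =>
  (h n f g hf hg).reindex (Sum.map id (Prod.map id k)) (by rintro (i | x) <;> rfl)
    (by rintro (i | x) <;> rfl)

/-- Cutting an indiscernible sequence into blocks, possibly sharing entries, yields an
indiscernible sequence as soon as the relative position of two blocks depends only on the order of
their indices. -/
theorem SameEM.blocks {Λ : Type*} [LinearOrder Λ] {c : I → M} {e : Λ → X → M}
    (h : SameEM L c e c e) {P : Type*} (idx : ℕ → P → Λ)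
    (hidx : ∀ j j' i i', (j < j' ↔ i < i') → (j' < j ↔ i' < i) →
      ∀ p p', idx j p < idx j' p' ↔ idx i p < idx i' p') :
    SameEM L c (fun j (q : P × X) => e (idx j q.1) q.2) c
      fun j (q : P × X) => e (idx j q.1) q.2 := by
  intro n f g hf hg
  have := h.posEquiv (J := Fin n × P) (f := fun p => idx (f p.1) p.2)
    (g := fun p => idx (g p.1) p.2) fun x y =>
      hidx _ _ _ _ (by rw [hf.lt_iff_lt, hg.lt_iff_lt]) (by rw [hf.lt_iff_lt, hg.lt_iff_lt]) _ _
  exact this.reindex (Sum.map id (Equiv.prodAssoc (Fin n) P X).symm)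
    (by rintro (i | x) <;> rfl) (by rintro (i | x) <;> rfl)

theorem IsIndiscernible.lascarDistLE {C : Set M} {t : ℕ → X → M} (h : IsIndiscernible L C t)
    (i j : ℕ) : LascarDistLE L C 1 (t i) (t j) :=
  ⟨fun k => if k = 0 then t i else t j, rfl, rfl, fun k hk => by
    obtain rfl : k = 0 := by omega
    exact ⟨t, h, ⟨i, rfl⟩, ⟨j, rfl⟩⟩⟩

theorem LascarDistLE.trans {C : Set M} {n m : ℕ} {a b c : X → M} (h : LascarDistLE L C n a b)
    (h' : LascarDistLE L C m b c) : LascarDistLE L C (n + m) a c := by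
  obtain ⟨s, rfl, rfl, hs⟩ := h
  obtain ⟨s', hs0, rfl, hs'⟩ := h'
  refine ⟨fun i => if i ≤ n then s i else s' (i - n), by simp, ?_, fun i hi => ?_⟩
  · rcases Nat.eq_zero_or_pos m with rfl | hm
    · simp [hs0]
    · simp [hm.ne']
  · rcases lt_trichotomy i n with h | rfl | h
    · simpa [h.le, Nat.succ_le_of_lt h] using hs i h
    · simpa [← hs0] using hs' 0 (by omega)
    · have := hs' (i - n) (by omega)
      simp only [if_neg (show ¬ i ≤ n by omega), if_neg (show ¬ i + 1 ≤ n by omega)]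
      rwa [show i + 1 - n = i - n + 1 by omega]

theorem LascarDistLE.comp {C : Set M} {n : ℕ} {a b : X → M} (h : LascarDistLE L C n a b)
    (k : Y → X) : LascarDistLE L C n (a ∘ k) (b ∘ k) := by
  obtain ⟨s, rfl, rfl, hs⟩ := h
  refine ⟨fun i => s i ∘ k, rfl, rfl, fun i hi => ?_⟩
  obtain ⟨t, ht, ⟨p, hp⟩, ⟨q, hq⟩⟩ := hs i hi
  refine ⟨fun i => t i ∘ k, ?_, ⟨p, congrArg (· ∘ k) hp⟩,
    ⟨q, congrArg (· ∘ k) hq⟩⟩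
  rw [isIndiscernible_iff_of_range_eq Subtype.range_val] at ht ⊢
  exact ht.comp k

theorem LsEquiv.comp {C : Set M} {a b : X → M} (h : LsEquiv L C a b) (k : Y → X) :
    LsEquiv L C (a ∘ k) (b ∘ k) := h.imp fun _ hn => hn.comp k

theorem LsEquiv.sameType {C : Set M} {a b : X → M} (h : LsEquiv L C a b) : SameType L C a b := by
  obtain ⟨n, s, rfl, rfl, hs⟩ := h
  induction n with
  | zero => exact fun φ _ => Iff.rfl
  | succ n ih =>
    refine PosEquiv.trans (ih fun i hi => hs i (by omega)) ?_
    obtain ⟨t, ht, ⟨p, hp⟩, ⟨q, hq⟩⟩ := hs n (by omega)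
    rw [← hp, ← hq]
    rw [isIndiscernible_iff_of_range_eq Subtype.range_val] at ht
    exact (ht.posEquiv (J := Unit) (f := fun _ => p) (g := fun _ => q) (by simp)).reindex
      (Sum.map id fun x => ((), x)) (by rintro (i | x) <;> rfl) (by rintro (i | x) <;> rfl)

theorem LascarDistLE.map_equiv {C : Set M} {n : ℕ} {a b : X → M} (h : LascarDistLE L C n a b)
    (f : M ≃[L] M) (hf : ∀ c ∈ C, f c = c) : LascarDistLE L C n (f ∘ a) (f ∘ b) := by
  obtain ⟨s, rfl, rfl, hs⟩ := h
  refine ⟨fun i => f ∘ s i, rfl, rfl, fun i hi => ?_⟩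
  obtain ⟨t, ht, ⟨p, hp⟩, ⟨q, hq⟩⟩ := hs i hi
  refine ⟨fun i => f ∘ t i, ?_, ⟨p, congrArg (f ∘ ·) hp⟩,
    ⟨q, congrArg (f ∘ ·) hq⟩⟩
  rw [isIndiscernible_iff_of_range_eq Subtype.range_val] at ht ⊢
  refine ht.transfer ((posEquiv_equiv f _).symm.reindex id (fun _ => rfl) ?_)
  rintro (c | x)
  · exact (hf c c.2).symm
  · rfl

/-- Whether `d_C(a, b) ≤ n` depends only on the type of `(a, b)` over `C`. -/
theorem IsMonster.lascarDistLE_congr {T : L.Theory} {κ : Cardinal.{w}} (hN : IsMonster T κ N)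
    {A X : Type w} (hA : #A < κ) (hX : #X < κ) {C : Set N} {c : A → N} (hc : range c = C)
    {a b a' b' : X → N}
    (h : PosEquiv L (Sum.elim c (Sum.elim a b)) (Sum.elim c (Sum.elim a' b'))) {n : ℕ}
    (hab : LascarDistLE L C n a b) : LascarDistLE L C n a' b' := by
  obtain ⟨f, hf⟩ := hN.exists_equiv (hN.sum_lt hA (hN.sum_lt hX hX)) h
  have ha : f ∘ a = a' := funext fun x => congrFun hf (.inr (.inl x))
  have hb : f ∘ b = b' := funext fun x => congrFun hf (.inr (.inr x))
  rw [← ha, ← hb]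
  refine hab.map_equiv f fun y hy => ?_
  obtain ⟨i, rfl⟩ := hc ▸ hy
  exact congrFun hf (.inl i)

/-- Any two increasing finite subtuples of an indiscernible sequence have the same Lascar strong
type: both lie at distance at most one from a subtuple far to the right. -/
theorem IsIndiscernible.lsEquiv {C : Set M} {t : ℕ → X → M} (h : IsIndiscernible L C t) {n : ℕ}
    {f g : Fin n → ℕ} (hf : StrictMono f) (hg : StrictMono g) :
    LsEquiv L C (fun p : Fin n × X => t (f p.1) p.2) fun p : Fin n × X => t (g p.1) p.2 := by
  have h' := h
  rw [isIndiscernible_iff_of_range_eq Subtype.range_val] at h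
  obtain ⟨B, hB⟩ : ∃ B : ℕ, ∀ i, f i < B ∧ g i < B := by
    refine ⟨(Finset.univ.sup f ⊔ Finset.univ.sup g) + 1, fun i => ⟨?_, ?_⟩⟩
    · exact Nat.lt_succ_of_le (le_sup_of_le_left (Finset.le_sup (Finset.mem_univ i)))
    · exact Nat.lt_succ_of_le (le_sup_of_le_right (Finset.le_sup (Finset.mem_univ i)))
  have key : ∀ f : Fin n → ℕ, StrictMono f → (∀ i, f i < B) →
      ∃ r : ℕ → Fin n × X → M, IsIndiscernible L C r ∧
        r 0 = (fun p => t (f p.1) p.2) ∧ r 1 = fun p => t (B + n * 1 + p.1) p.2 := by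
    intro f hf hfB
    let idx : ℕ → Fin n → ℕ := fun j i => if j = 0 then f i else B + n * j + i
    refine ⟨fun j p => t (idx j p.1) p.2, ?_, by simp [idx], by simp [idx]⟩
    rw [isIndiscernible_iff_of_range_eq Subtype.range_val]
    refine h.blocks idx ?_
    have hlt : ∀ j j' p p', j < j' → idx j p < idx j' p' := by
      intro j j' p p' hj
      have h1 : n * j + n ≤ n * j' := by
        rw [← Nat.mul_succ]; exact Nat.mul_le_mul_left _ hj
      have := hfB p
      have := p.2
      simp only [idx]
      split_ifs <;> omega
    have heq : ∀ j p p', idx j p < idx j p' ↔ p < p' := by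
      intro j p p'
      simp only [idx]
      split_ifs
      · exact hf.lt_iff_lt
      · simp
    intro j j' i i' h1 h2 p p'
    rcases lt_trichotomy j j' with hj | rfl | hj
    · exact iff_of_true (hlt _ _ _ _ hj) (hlt _ _ _ _ (h1.1 hj))
    · obtain rfl : i = i' := by omega
      rw [heq, heq]
    · exact iff_of_false (hlt _ _ _ _ hj).not_gt (hlt _ _ _ _ (h2.1 hj)).not_gt
  obtain ⟨r, hr, hr0, hr1⟩ := key f hf fun i => (hB i).1
  obtain ⟨r', hr', hr0', hr1'⟩ := key g hg fun i => (hB i).2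
  have h1 := hr.lascarDistLE 0 1
  have h2 := hr'.lascarDistLE 1 0
  rw [hr0, hr1] at h1
  rw [hr0', hr1'] at h2
  exact ⟨_, h1.trans h2⟩

end Lascar

/-! ### Thickness -/

section Thick

variable {L : FirstOrder.Language.{u, v}} {T : L.Theory} {κ κ' : Cardinal.{w}}
  {M N : Type w} [L.Structure M] [L.Structure N]

/-- Thickness does not depend on the monster model in which it is read. -/
theorem IsThick.of_hom [Nonempty M] [Nonempty N] (h : IsThick L M) (hM : IsMonster T κ M)
    (hN : IsMonster T κ' N) (ι : M →[L] N) : IsThick L N := by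
  intro k
  obtain ⟨Θ, hΘ, hΘM⟩ := h k
  refine ⟨Θ, hΘ, fun a => ?_⟩
  have h0 : #(PEmpty.{w + 1}) < κ := by simpa using aleph0_pos.trans hM.aleph0_lt
  have hV : #(ULift.{w} (ℕ × Fin k)) < κ := mk_le_aleph0.trans_lt hM.aleph0_lt
  obtain ⟨d, hd⟩ := hM.exists_reflection hN ι h0 hV PEmpty.elim fun p => a p.down.1 p.down.2
  let b : ℕ → Fin k → M := fun i j => d ⟨(i, j)⟩
  have hab : PosEquiv L (fun p : ℕ × Fin k => a p.1 p.2) (fun p => b p.1 p.2) :=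
    (hd.reindex (fun p => .inr ⟨p⟩) (fun _ => rfl) fun _ => rfl).trans
      ((hM.isImmersion hN ι).posEquiv fun p : ℕ × Fin k => b p.1 p.2)
  have hab' : PosEquiv L (Sum.elim (PEmpty.elim : PEmpty.{w + 1} → N)
      fun p : ℕ × Fin k => a p.1 p.2) (Sum.elim PEmpty.elim fun p => b p.1 p.2) :=
    hab.reindex (Sum.elim PEmpty.elim id) (by rintro (x | x); exacts [x.elim, rfl])
      (by rintro (x | x); exacts [x.elim, rfl])
  rw [isIndiscernible_iff_of_range_eq (c := (PEmpty.elim : PEmpty.{w + 1} → N)) (range_eq_empty _),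
    show SameEM L PEmpty.elim a PEmpty.elim a ↔ SameEM L PEmpty.elim b PEmpty.elim b from
      ⟨fun h => h.transfer hab', fun h => h.transfer hab'.symm⟩,
    ← isIndiscernible_iff_of_range_eq (C := ∅) (range_eq_empty _), ← hΘM]
  exact forall₂_congr fun φ hφ => hab φ (hΘ φ hφ)

/-- In a thick theory indiscernibility over any tuple of parameters, for sequences of tuples of
any length, is type-definable. -/
theorem IsThick.exists_type (h : IsThick L N) (I X : Type*) :
    ∃ Θ : Set (L.Formula (I ⊕ ℕ × X)), (∀ φ ∈ Θ, IsPositive φ) ∧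
      ∀ (c : I → N) (a : ℕ → X → N),
        (∀ φ ∈ Θ, φ.Realize (Sum.elim c fun p => a p.1 p.2)) ↔ SameEM L c a c a := by
  choose Θ hΘ hΘN using h
  let r : (k : ℕ) → (Fin k → I ⊕ X) → ℕ × Fin k → I ⊕ ℕ × X := fun k f p =>
    Sum.map id (fun x => (p.1, x)) (f p.2)
  refine ⟨{φ | ∃ k f, ∃ θ ∈ Θ k, φ = θ.relabel (r k f)}, ?_, fun c a => ?_⟩
  · rintro _ ⟨k, f, θ, hθ, rfl⟩
    exact (hΘ k θ hθ).relabel _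
  have hr : ∀ k (f : Fin k → I ⊕ X), (Sum.elim c fun p : ℕ × X => a p.1 p.2) ∘ r k f =
      fun p : ℕ × Fin k => Sum.elim c (a p.1) (f p.2) := by
    intro k f
    funext p
    simp only [Function.comp_apply, r]
    rcases f p.2 with i | x <;> rfl
  have h1 : (∀ φ ∈ {φ | ∃ k f, ∃ θ ∈ Θ k, φ = θ.relabel (r k f)},
      φ.Realize (Sum.elim c fun p => a p.1 p.2)) ↔
      ∀ k (f : Fin k → I ⊕ X), IsIndiscernible L ∅ fun i j => Sum.elim c (a i) (f j) := by
    simp only [← hΘN]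
    constructor
    · intro h k f θ hθ
      have := h _ ⟨k, f, θ, hθ, rfl⟩
      rwa [Formula.realize_relabel, hr] at this
    · rintro h _ ⟨k, f, θ, hθ, rfl⟩
      rw [Formula.realize_relabel, hr]
      exact h k f θ hθ
  rw [h1]
  have hE : ∀ k (t : ℕ → Fin k → N), IsIndiscernible L ∅ t ↔
      SameEM L (PEmpty.elim : PEmpty.{1} → N) t PEmpty.elim t :=
    fun k t => isIndiscernible_iff_of_range_eq (range_eq_empty _)
  simp only [hE]
  constructor
  · intro h n f g hf hg
    rcases Nat.eq_zero_or_pos n with rfl | hn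
    · obtain rfl : f = g := Subsingleton.elim _ _
      exact PosEquiv.refl _
    refine posEquiv_of_fin fun m k => ?_
    have := h m (fun j => Sum.map id Prod.snd (k j)) n f g hf hg
    -- Parameters are constant along the sequence, so any index may be used for them.
    refine this.reindex (fun j => .inr (Sum.elim (fun _ => ⟨0, hn⟩) Prod.fst (k j), j)) ?_ ?_ <;>
    · intro j
      simp only [Function.comp_apply, Sum.elim_inr]
      rcases k j with i | p <;> rfl
  · intro h k f n F G hF hG
    refine (h n F G hF hG).reindex
      (Sum.elim PEmpty.elim fun p => Sum.map id (fun x => (p.1, x)) (f p.2)) ?_ ?_ <;>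
    · rintro (x | p)
      · exact x.elim
      · simp only [Sum.elim_inr]
        rcases f p.2 with i | x <;> rfl

/-- In a thick theory, indiscernibility of `(γ t_i)_i` over `C` is expressed by positive formulas
in `γ`, and hence is inherited by any `γ` satisfying all positive formulas that it implies. -/
theorem IsThick.isIndiscernible_of_forced (h : IsThick L N) {A X Z : Type*} {C : Set N}
    {d : A → N} (hC : C ⊆ range d) {t : ℕ → Z → N} (ht : ∀ i z, t i z ∈ range d) {γ : X → N}
    (hγ : ∀ φ : L.Formula (A ⊕ X), IsPositive φ →
      (∀ δ : X → N, IsIndiscernible L C (fun i => Sum.elim δ (t i)) →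
        φ.Realize (Sum.elim d δ)) → φ.Realize (Sum.elim d γ)) :
    IsIndiscernible L C fun i => Sum.elim γ (t i) := by
  obtain ⟨Θ, hΘ, hΘN⟩ := h.exists_type C (X ⊕ Z)
  have hC' : ∀ c : C, ∃ x, d x = c := fun c => hC c.2
  choose dc hdc using hC'
  choose dt hdt using ht
  let r : C ⊕ ℕ × (X ⊕ Z) → A ⊕ X :=
    Sum.elim (fun c => .inl (dc c)) fun p => Sum.elim .inr (fun z => .inl (dt p.1 z)) p.2
  have hr : ∀ δ : X → N, Sum.elim d δ ∘ r =
      Sum.elim (Subtype.val : C → N) fun p : ℕ × (X ⊕ Z) => Sum.elim δ (t p.1) p.2 := by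
    intro δ
    funext p
    rcases p with c | ⟨i, x | z⟩
    · exact hdc c
    · rfl
    · exact hdt i z
  simp only [isIndiscernible_iff_of_range_eq Subtype.range_val] at hγ ⊢
  refine (hΘN _ _).1 fun φ hφ => ?_
  have := hγ (φ.relabel r) ((hΘ φ hφ).relabel r) fun δ hδ => by
    rw [Formula.realize_relabel, hr]
    exact (hΘN _ _).2 hδ φ hφ
  rwa [Formula.realize_relabel, hr] at this

end Thick

/-! ### Lascar invariance through indiscernible sequences -/

section Invariance

variable {L : FirstOrder.Language.{u, v}} {T : L.Theory} {κ κ' : Cardinal.{w}}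
  {M N : Type w} [L.Structure M] [L.Structure N] {X : Type w}

variable (L) in
/-- Every `C`-indiscernible sequence of small tuples from `D` stays `C`-indiscernible after `α` is
adjoined to each of its terms. Over a monster model this is equivalent to the `C`-Ls-invariance of
the Lascar strong type of `α`, but it refers to types only. -/
def PreservesIndiscernibles (κ : Cardinal.{w}) (C D : Set N) (α : X → N) : Prop :=
  ∀ Z : Type w, #Z < κ → ∀ t : ℕ → Z → N, (∀ i z, t i z ∈ D) → IsIndiscernible L C t →
    IsIndiscernible L C fun i => Sum.elim α (t i)

theorem LsInvariantOver.preservesIndiscernibles (hκ : ℵ₀ < κ) {C D : Set N} {α : X → N}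
    (h : LsInvariantOver L κ C D α) : PreservesIndiscernibles L κ C D α := by
  intro Z hZ t htD ht n f g hf hg
  have hY : #(Fin n × Z) < κ := by
    rw [mk_prod]
    exact mul_lt_of_lt hκ.le (by simpa using natCast_lt_aleph0.trans hκ) (by rwa [lift_uzero])
  have := (h (Fin n × Z) hY _ _ (range_subset_iff.2 fun p => htD _ _)
    (range_subset_iff.2 fun p => htD _ _) (ht.lsEquiv hf hg)).sameType
  exact PosEquiv.reindex this (Sum.map id fun p => Sum.map id (fun z => (p.1, z)) p.2)
    (by rintro (c | ⟨i, x | z⟩) <;> rfl) (by rintro (c | ⟨i, x | z⟩) <;> rfl)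

/-- Every small set `B` is contained in a small set `D` containing, for any two small tuples from
`B` with the same Lascar strong type, indiscernible sequences witnessing this. Preserving the
indiscernible sequences of `D` therefore gives Lascar invariance over `B`. -/
theorem IsMonster.exists_lascar_closed [Nonempty N] (hN : IsMonster T κ' N) (κ : Cardinal.{w})
    (C : Set N) {B : Set N} (hB : #B < κ') :
    ∃ D : Set N, B ⊆ D ∧ #D < κ' ∧ ∀ α : X → N, PreservesIndiscernibles L κ C D α →
      LsInvariantOver L κ C B α := by
  classical
  -- A pair of tuples from `B` is coded, up to repetitions, by a subset of `B × B`.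
  have key : ∀ R : Set (B × B), ∃ (n : ℕ) (s : ℕ → R → N) (t : ℕ → ℕ → R → N),
      LsEquiv L C (fun r : R => (r.1.1 : N)) (fun r : R => (r.1.2 : N)) →
        s 0 = (fun r : R => (r.1.1 : N)) ∧ s n = (fun r : R => (r.1.2 : N)) ∧
        ∀ i < n, IsIndiscernible L C (t i) ∧ s i ∈ range (t i) ∧ s (i + 1) ∈ range (t i) := by
    intro R
    by_cases hR : LsEquiv L C (fun r : R => (r.1.1 : N)) (fun r : R => (r.1.2 : N))
    · obtain ⟨n, s, hs0, hsn, hs⟩ := hR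
      choose! t ht using hs
      exact ⟨n, s, t, fun _ => ⟨hs0, hsn, ht⟩⟩
    · exact ⟨0, fun _ r => r.1.1, fun _ _ r => r.1.1, fun h => absurd h hR⟩
  choose n s t hst using key
  let g : Set (B × B) × ((ℕ × ℕ) × (B × B)) → N := fun p =>
    if h : p.2.2 ∈ p.1 then t p.1 p.2.1.1 p.2.1.2 ⟨p.2.2, h⟩ else Classical.arbitrary N
  have hBB : #(B × B) < κ' := hN.prod_lt hB hB
  have hg : #(range g) < κ' := mk_range_le.trans_lt
    (hN.prod_lt (by rw [mk_set]; exact hN.two_power_lt hBB) (hN.countable_prod_lt hBB))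
  refine ⟨B ∪ range g, subset_union_left, (mk_union_le _ _).trans_lt
    (add_lt_of_lt hN.aleph0_lt.le hB hg), fun α hα Y hY b b' hb hb' hbb' => ?_⟩
  let k : Y → B × B := fun y => (⟨b y, hb ⟨y, rfl⟩⟩, ⟨b' y, hb' ⟨y, rfl⟩⟩)
  let R := range k
  have hR : ∀ r : R, ∃ y, k y = r := fun r => r.2
  choose σ hσ using hR
  have hLs : LsEquiv L C (fun r : R => (r.1.1 : N)) (fun r : R => (r.1.2 : N)) := by
    convert! hbb'.comp σ using 1
    · funext r; rw [← hσ r]; rfl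
    · funext r; rw [← hσ r]; rfl
  obtain ⟨h0, hn, hi⟩ := hst R hLs
  have hdist : LsEquiv L C (Sum.elim α (fun r : R => (r.1.1 : N)))
      (Sum.elim α (fun r : R => (r.1.2 : N))) := by
    refine ⟨n R, fun i => Sum.elim α (s R i), congrArg (Sum.elim α) h0, congrArg (Sum.elim α) hn,
      fun i hi' => ?_⟩
    obtain ⟨hind, ⟨p, hp⟩, ⟨q, hq⟩⟩ := hi i hi'
    refine ⟨_, hα R (mk_range_le.trans_lt hY) (t R i) (fun j r => .inr ⟨(R, (i, j), r), ?_⟩) hind,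
      ⟨p, congrArg (Sum.elim α) hp⟩, ⟨q, congrArg (Sum.elim α) hq⟩⟩
    exact dif_pos r.2
  convert! hdist.comp (Sum.map id (rangeFactorization k)) using 1
  · funext z; rcases z with x | y <;> rfl
  · funext z; rcases z with x | y <;> rfl

end Invariance

/-! ### Extending invariant types to larger sets -/

section Extension

variable {L : FirstOrder.Language.{u, v}} {T : L.Theory} {κ κ' : Cardinal.{w}}
  {M N : Type w} [L.Structure M] [L.Structure N] [Nonempty M] [Nonempty N] {X : Type w}

/-- If `β` preserves the indiscernible sequences of `M`, then for every small `E ⊆ N` some tuple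
with the same type as `β` over `M ∩ E` preserves the indiscernible sequences of `E`: reflect `E`
into `M` over `C ∪ (M ∩ E)`, and let the tuple stand to `E` as `β` stands to the reflection. -/
theorem PreservesIndiscernibles.exists_of_small (hM : IsMonster T κ M) (hN : IsMonster T κ' N)
    (hκ : κ ≤ κ') {ι : M →[L] N} {C : Set M} (hC : #C < κ) (hX : #X < κ) {β : X → N}
    (hβ : PreservesIndiscernibles L κ (ι '' C) (range ι) β) {E : Set N} (hE : #E < κ) :
    ∃ γ : X → N, PosEquiv L (Sum.elim (fun m : ι ⁻¹' E => ι m) β)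
        (Sum.elim (fun m : ι ⁻¹' E => ι m) γ) ∧
      PreservesIndiscernibles L κ (ι '' C) E γ := by
  have hι := hM.isImmersion hN ι
  have hE' : #(ι ⁻¹' E) < κ := (mk_preimage_of_injective _ _ hι.injective).trans_lt hE
  have hA : #(C ⊕ ι ⁻¹' E) < κ := hM.sum_lt hC hE'
  let a : C ⊕ ι ⁻¹' E → M := Sum.elim Subtype.val Subtype.val
  obtain ⟨e, he⟩ := hM.exists_reflection hN ι hA hE a (Subtype.val : E → N)
  obtain ⟨γ, hγ⟩ := hN.exists_extension ((hM.sum_lt hA hE).trans_le hκ) (hX.trans_le hκ) he.symm β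
  refine ⟨γ, hγ.reindex (Sum.elim (fun m => .inl (.inl (.inr m))) .inr)
    (by rintro (m | x) <;> rfl) (by rintro (m | x) <;> rfl), fun Z hZ t htE ht => ?_⟩
  have hc : range (fun c : C => ι c) = ι '' C := by rw [image_eq_range]
  rw [isIndiscernible_iff_of_range_eq hc] at ht ⊢
  let t' : ℕ → Z → N := fun i z => ι (e ⟨t i z, htE i z⟩)
  have ht' : SameEM L (fun c : C => ι c) t' (fun c : C => ι c) t' := by
    refine ht.transfer (he.reindex
      (Sum.elim (fun c => .inl (.inl c)) fun p => .inr ⟨t p.1 p.2, htE p.1 p.2⟩) ?_ ?_)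
    · rintro (c | p) <;> rfl
    · rintro (c | p) <;> rfl
  have h1 := hβ Z hZ t' (fun i z => ⟨_, rfl⟩) ((isIndiscernible_iff_of_range_eq hc).2 ht')
  rw [isIndiscernible_iff_of_range_eq hc] at h1
  refine h1.transfer (hγ.reindex (Sum.elim (fun c => .inl (.inl (.inl c)))
    fun p => Sum.elim .inr (fun z => .inl (.inr ⟨t p.1 z, htE p.1 z⟩)) p.2) ?_ ?_)
  · rintro (c | ⟨i, x | z⟩) <;> rfl
  · rintro (c | ⟨i, x | z⟩) <;> rfl

/-- A type over `M` preserving indiscernible sequences has, over any small subset `B` of the bigger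
monster model, a realisation whose Lascar strong type over `B` is `C`-Ls-invariant. -/
theorem PreservesIndiscernibles.exists_lsInvariantOver (hM : IsMonster T κ M)
    (hN : IsMonster T κ' N) (hκ : κ ≤ κ') (hMN : #M < κ') (hthick : IsThick L N) {ι : M →[L] N}
    {C : Set M} (hC : #C < κ) (hX : #X < κ) {β : X → N}
    (hβ : PreservesIndiscernibles L κ (ι '' C) (range ι) β) {B : Set N} (hB : #B < κ') :
    ∃ γ : X → N, PosEquiv L (Sum.elim ι β) (Sum.elim ι γ) ∧
      LsInvariantOver L κ (ι '' C) B γ := by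
  classical
  have hB' : #(B ∪ range ι : Set N) < κ' := (mk_union_le _ _).trans_lt
    (add_lt_of_lt hN.aleph0_lt.le hB (mk_range_le.trans_lt hMN))
  obtain ⟨D, hBD, hD, hDB⟩ := hN.exists_lascar_closed (X := X) κ (ι '' C) hB'
  have hιD : ∀ m, ι m ∈ D := fun m => hBD (.inr ⟨m, rfl⟩)
  have : Nonempty {E : Set N // #E < κ} := ⟨⟨∅, by simpa using aleph0_pos.trans hM.aleph0_lt⟩⟩
  obtain ⟨γ, hγ⟩ := hN.exists_realize_forced hD (hX.trans_le hκ) (Subtype.val : D → N)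
    (I := {E : Set N // #E < κ})
    (fun E γ => PosEquiv L (Sum.elim (fun m : ι ⁻¹' E.1 => ι m) β)
        (Sum.elim (fun m : ι ⁻¹' E.1 => ι m) γ) ∧
      PreservesIndiscernibles L κ (ι '' C) E.1 γ)
    (fun E F => ⟨⟨E.1 ∪ F.1, (mk_union_le _ _).trans_lt (add_lt_of_lt hM.aleph0_lt.le E.2 F.2)⟩,
      fun δ hδ => ⟨⟨hδ.1.reindex (Sum.map (fun m => ⟨m.1, .inl m.2⟩) id)
          (by rintro (m | x) <;> rfl) (by rintro (m | x) <;> rfl),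
          fun Z hZ t ht => hδ.2 Z hZ t fun i z => .inl (ht i z)⟩,
        hδ.1.reindex (Sum.map (fun m => ⟨m.1, .inr m.2⟩) id)
          (by rintro (m | x) <;> rfl) (by rintro (m | x) <;> rfl),
          fun Z hZ t ht => hδ.2 Z hZ t fun i z => .inr (ht i z)⟩⟩)
    (fun E => hβ.exists_of_small hM hN hκ hC hX E.2)
  refine ⟨γ, hN.posEquiv_of_posLE fun φ hφ hφβ => ?_, fun Y hY b b' hb hb' =>
    hDB γ (fun Z hZ t ht hind => ?_) Y hY b b' (hb.trans subset_union_left)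
      (hb'.trans subset_union_left)⟩
  · -- Only the finitely many parameters of `φ` matter.
    obtain ⟨n, g, ψ, hψ, hφψ⟩ := IsPositive.exists_fin.{u, v, w} hφ
    let E : Set N := range fun i => Sum.elim ι (fun _ => Classical.arbitrary N) (g i)
    have hE : #E < κ := (lt_aleph0_of_finite E).trans hM.aleph0_lt
    have hg : ∀ i, ∃ p : ι ⁻¹' E ⊕ X, Sum.map Subtype.val id p = g i := by
      intro i
      rcases hi : g i with m | x
      · exact ⟨.inl ⟨m, i, by simp [hi]⟩, rfl⟩
      · exact ⟨.inr x, rfl⟩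
    choose g' hg' using hg
    have hr : ∀ δ : X → N, Sum.elim ι δ ∘ g = Sum.elim (fun m : ι ⁻¹' E => ι m) δ ∘ g' := by
      intro δ
      funext i
      rw [Function.comp_apply, ← hg' i, Function.comp_apply]
      rcases g' i with m | x <;> rfl
    have hι : ∀ δ : X → N, Sum.elim (Subtype.val : D → N) δ ∘
        Sum.map (fun m => ⟨ι m, hιD m⟩) id = Sum.elim ι δ := by
      intro δ
      funext p
      rcases p with m | x <;> rfl
    have := hγ ⟨E, hE⟩ (φ.relabel (Sum.map (fun m => ⟨ι m, hιD m⟩) id)) (hφ.relabel _)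
      fun δ hδ => by
        rw [Formula.realize_relabel, hι, hφψ, hr, ← hδ.1.comp g' ψ hψ, ← hr, ← hφψ]
        exact hφβ
    rwa [Formula.realize_relabel, hι] at this
  · refine hthick.isIndiscernible_of_forced (d := (Subtype.val : D → N)) ?_ ?_
      fun φ hφ h => hγ ⟨range fun p : ℕ × Z => t p.1 p.2,
        mk_range_le.trans_lt (hM.countable_prod_lt hZ)⟩ φ hφ
        fun δ hδ => h δ (hδ.2 Z hZ t (fun i z => ⟨(i, z), rfl⟩) hind)
    · rintro _ ⟨m, _, rfl⟩
      exact ⟨⟨ι m, hιD m⟩, rfl⟩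
    · exact fun i z => ⟨⟨t i z, ht i z⟩, rfl⟩

end Extension

/-! ### Global types and their realisations -/

section Global

variable {L : FirstOrder.Language.{u, v}} {T : L.Theory} {κ κ' : Cardinal.{w}}
  {M N : Type w} [L.Structure M] [L.Structure N] {X : Type w}

theorem IsGlobalPartialType.exists_realize (hM : IsMonster T κ M) (hN : IsMonster T κ' N)
    (hMN : #M < κ') (hX : #X < κ') (ι : M →[L] N) {S : Set (L.Formula (M ⊕ X))}
    (hS : IsGlobalPartialType L M X S) : ∃ γ : X → N, ∀ φ ∈ S, φ.Realize (Sum.elim ι γ) := by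
  classical
  have hι := hM.isImmersion hN ι
  have : Nonempty {F : Finset (L.Formula (M ⊕ X)) // ↑F ⊆ S} := ⟨⟨∅, by simp⟩⟩
  obtain ⟨γ, hγ⟩ := hN.exists_realize_forced hMN hX ι
    (I := {F : Finset (L.Formula (M ⊕ X)) // ↑F ⊆ S})
    (fun F γ => ∀ φ ∈ F.1, φ.Realize (Sum.elim ι γ))
    (fun F G => ⟨⟨F.1 ∪ G.1, by rw [Finset.coe_union]; exact union_subset F.2 G.2⟩, fun δ hδ =>
      ⟨fun φ hφ => hδ φ (Finset.mem_union_left _ hφ),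
        fun φ hφ => hδ φ (Finset.mem_union_right _ hφ)⟩⟩)
    (fun F => by
      obtain ⟨b, hb⟩ := hS.finSat F.1 F.2
      refine ⟨ι ∘ b, fun φ hφ => ?_⟩
      have := (hι.posEquiv (Sum.elim id b) φ (hS.positive φ (F.2 hφ))).2 (hb φ hφ)
      rwa [Sum.comp_elim] at this)
  exact ⟨γ, fun φ hφ => hγ ⟨{φ}, by simpa using hφ⟩ φ (hS.positive φ hφ)
    fun δ hδ => hδ φ (Finset.mem_singleton_self _)⟩

/-- The type over `M` of a small tuple of the bigger monster model is a global type. -/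
theorem exists_globalType [Nonempty M] [Nonempty N] (hM : IsMonster T κ M)
    (hN : IsMonster T κ' N) (hMN : #M < κ') (hX : #X < κ') (ι : M →[L] N) (β : X → N) :
    ∃ q : GlobalType L M X, q.formulas =
      {φ : L.Formula (M ⊕ X) | IsPositive φ ∧ φ.Realize (Sum.elim ι β)} := by
  classical
  have hι := hM.isImmersion hN ι
  refine ⟨⟨{φ : L.Formula (M ⊕ X) | IsPositive φ ∧ φ.Realize (Sum.elim ι β)},
    ⟨fun φ hφ => hφ.1, fun F hF => ?_⟩,
    fun S hS hβS => ?_⟩, rfl⟩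
  · obtain ⟨ψ, hψ, hψF⟩ := exists_positive_iff_exists_realize.{u, v, w} F fun φ hφ => (hF hφ).1
    exact (hψF M id).1 ((hι.posEquiv id ψ hψ).1 ((hψF N ι).2 ⟨β, fun φ hφ => (hF hφ).2⟩))
  · obtain ⟨γ, hγ⟩ := hS.exists_realize hM hN hMN hX ι
    have h : PosEquiv L (Sum.elim ι β) (Sum.elim ι γ) :=
      hN.posEquiv_of_posLE fun φ hφ hr => hγ φ (hβS ⟨hφ, hr⟩)
    exact (subset_antisymm hβS fun φ hφ =>
      ⟨hS.positive φ hφ, (h φ (hS.positive φ hφ)).2 (hγ φ hφ)⟩).symm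

end Global

/-! ### A type that continues the sequence -/

section Continuation

variable {L : FirstOrder.Language.{u, v}} {T : L.Theory} {κ κ' : Cardinal.{w}}
  {M N : Type w} [L.Structure M] [L.Structure N] [Nonempty N] {X : Type w}

/-- The limit step: from `C`-Ls-invariant extensions of the types `tp(a_n / C a_{<n})`, compactness
and thickness produce one tuple that preserves the indiscernible sequences of `M` and realises the
limit of these types. -/
theorem exists_continuation (hM : IsMonster T κ M) (hN : IsMonster T κ' N) (hκ : κ ≤ κ')
    (hMN : #M < κ') (hthick : IsThick L N) (ι : M →[L] N) {C : Set M} (hX : #X < κ)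
    {a : ℕ → X → M} (hind : IsIndiscernible L C a)
    (hindep : ∀ i, ILsIndep κ ι C (a i) {e | ∃ j < i, e ∈ range (a j)}) :
    ∃ β : X → N, PreservesIndiscernibles L κ (ι '' C) (range ι) β ∧
      ∀ n, PosEquiv L
        (Sum.elim (fun c : C => ι c) (Sum.elim (fun p : Fin n × X => ι (a p.1 p.2)) β))
        (Sum.elim (fun c : C => ι c)
          (Sum.elim (fun p : Fin n × X => ι (a p.1 p.2)) fun x => ι (a n x))) := by
  have hι := hM.isImmersion hN ι
  have hX' := hX.trans_le hκ
  have hind' : SameEM L (Subtype.val : C → M) a Subtype.val a :=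
    (isIndiscernible_iff_of_range_eq Subtype.range_val).1 hind
  let P : ℕ → (X → N) → Prop := fun n γ => PreservesIndiscernibles L κ (ι '' C) (range ι) γ ∧
    PosEquiv L (Sum.elim (fun c : C => ι c) (Sum.elim (fun p : Fin n × X => ι (a p.1 p.2)) γ))
      (Sum.elim (fun c : C => ι c)
        (Sum.elim (fun p : Fin n × X => ι (a p.1 p.2)) fun x => ι (a n x)))
  have hmono : ∀ n m γ, n ≤ m → P m γ → P n γ := by
    rintro n m γ hnm ⟨h1, h2⟩
    refine ⟨h1, PosEquiv.trans (h2.reindex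
      (Sum.map id (Sum.map (Prod.map (Fin.castLE hnm) id) id)) ?_ fun _ => rfl) ?_⟩
    · rintro (c | p | x) <;> rfl
    · have h3 := hind'.posEquiv (J := Fin n ⊕ Unit) (f := Sum.elim (fun i => (i : ℕ)) fun _ => m)
        (g := Sum.elim (fun i => (i : ℕ)) fun _ => n) (by
          rintro (i | i) (j | j) <;> simp <;> omega)
      refine (((hι.posEquiv _).trans h3).trans (hι.posEquiv _).symm).reindex
        (Sum.map id (Sum.elim (fun p => (.inl p.1, p.2)) fun x => (.inr (), x))) ?_ ?_
      · rintro (c | p | x) <;> rfl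
      · rintro (c | p | x) <;> rfl
  obtain ⟨β, hβ⟩ := hN.exists_realize_forced hMN hX' ι P
    (fun i j => ⟨max i j, fun γ hγ => ⟨hmono _ _ γ (le_max_left _ _) hγ,
      hmono _ _ γ (le_max_right _ _) hγ⟩⟩)
    (by
      intro n
      obtain ⟨q, hq, hqinv⟩ := hindep n
      obtain ⟨γ, hγ⟩ := q.isPartialType.exists_realize hM hN hMN hX' ι
      refine ⟨γ, (hqinv γ hγ).preservesIndiscernibles hM.aleph0_lt, ?_⟩
      have h : PosEquiv L
          (Sum.elim (fun b : (C ∪ {e | ∃ j < n, e ∈ range (a j)} : Set M) => ι b)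
            fun x => ι (a n x))
          (Sum.elim (fun b => ι b) γ) := by
        refine hN.posEquiv_of_posLE fun φ hφ hr => ?_
        have := hγ _ (hq φ hφ ((hι.posEquiv _ φ hφ).1 (by rw [Sum.comp_elim]; exact hr)))
        rw [Formula.realize_relabel, Sum.elim_comp_map] at this
        exact this
      refine h.symm.reindex (Sum.elim (fun c : C => .inl ⟨c, .inl c.2⟩) (Sum.elim
        (fun p : Fin n × X => .inl ⟨a p.1 p.2, .inr ⟨p.1, p.1.2, p.2, rfl⟩⟩) .inr)) ?_ ?_
      · rintro (c | p | x) <;> rfl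
      · rintro (c | p | x) <;> rfl)
  refine ⟨β, fun Z hZ t htM ht => ?_, fun n => PosEquiv.symm (hN.posEquiv_of_posLE ?_)⟩
  · exact hthick.isIndiscernible_of_forced (image_subset_range _ _) htM fun φ hφ h =>
      hβ 0 φ hφ fun δ hδ => h δ (hδ.1 Z hZ t htM ht)
  · intro φ hφ hr
    let r : C ⊕ Fin n × X ⊕ X → M ⊕ X := Sum.elim (fun c => .inl c)
      (Sum.elim (fun p => .inl (a p.1 p.2)) .inr)
    have hrδ : ∀ δ : X → N, Sum.elim ι δ ∘ r = Sum.elim (fun c : C => ι c)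
        (Sum.elim (fun p : Fin n × X => ι (a p.1 p.2)) δ) := by
      intro δ
      funext p
      rcases p with c | p | x <;> rfl
    have := hβ n (φ.relabel r) (hφ.relabel r) fun δ hδ => by
      rw [Formula.realize_relabel, hrδ]
      exact (hδ.2 φ hφ).2 hr
    rwa [Formula.realize_relabel, hrδ] at this

/-- Stretching: an indiscernible sequence indexed by `ℕ` has the same Ehrenfeucht–Mostowski type as
some sequence indexed by a given countable linear order. -/
theorem SameEM.exists_stretch (hN : IsMonster T κ N) {A : Type w} (hA : #A < κ) (hX : #X < κ)
    {c : A → N} {a : ℕ → X → N} (h : SameEM L c a c a) (Λ : Type) [LinearOrder Λ] [Countable Λ] :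
    ∃ e : Λ → X → N, SameEM L c e c a := by
  classical
  obtain ⟨e, he⟩ := hN.exists_realize_forced hA (hN.countable_prod_lt (J := Λ) hX) c
    (I := Finset Λ)
    (fun s γ => ∃ k : Λ → ℕ, StrictMonoOn k s ∧ γ = fun p => a (k p.1) p.2)
    (fun s t => ⟨s ∪ t, by
      rintro γ ⟨k, hk, rfl⟩
      rw [Finset.coe_union] at hk
      exact ⟨⟨k, hk.mono subset_union_left, rfl⟩, ⟨k, hk.mono subset_union_right, rfl⟩⟩⟩)
    (fun s => by
      -- A point is sent to the number of points of `s` below it.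
      refine ⟨_, fun x => (s.filter (· < x)).card, fun x hx y _ hxy => ?_, rfl⟩
      refine Finset.card_lt_card ⟨fun z hz => ?_, fun hsub => ?_⟩
      · rw [Finset.mem_filter] at hz ⊢
        exact ⟨hz.1, hz.2.trans hxy⟩
      · have := hsub (Finset.mem_filter.2 ⟨hx, hxy⟩)
        exact lt_irrefl _ (Finset.mem_filter.1 this).2)
  refine ⟨fun i x => e (i, x), fun n f g hf hg =>
    PosEquiv.symm (hN.posEquiv_of_posLE fun φ hφ hr => ?_)⟩
  have hr' : ∀ γ : Λ × X → N, Sum.elim c γ ∘ Sum.map id (Prod.map f id) =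
      Sum.elim c fun p : Fin n × X => γ (f p.1, p.2) := by
    intro γ
    funext p
    rcases p with x | p <;> rfl
  have := he (Finset.univ.image f) (φ.relabel (Sum.map id (Prod.map f id))) (hφ.relabel _) (by
    rintro _ ⟨k, hk, rfl⟩
    rw [Formula.realize_relabel, hr']
    refine (h n g (k ∘ f) hg (fun i j hij => hk ?_ ?_ (hf hij)) φ hφ).1 hr <;> simp)
  rwa [Formula.realize_relabel, hr'] at this

end Continuation

/-! ### The Morley sequence -/

section Morley

variable {L : FirstOrder.Language.{u, v}} {T : L.Theory} {κ κ' : Cardinal.{w}}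
  {M N : Type w} [L.Structure M] [L.Structure N] {X : Type w}

/-- Lascar invariance over `M` depends only on the type over `M`. -/
theorem LsInvariantOver.congr (hN : IsMonster T κ' N) (hκ : κ ≤ κ') {ι : M →[L] N} {C : Set M}
    (hC : #C < κ) (hX : #X < κ) {α γ : X → N} (h : LsInvariantOver L κ (ι '' C) (range ι) γ)
    (hγα : PosEquiv L (Sum.elim ι γ) (Sum.elim ι α)) :
    LsInvariantOver L κ (ι '' C) (range ι) α := by
  intro Y hY b b' hb hb' hbb'
  have hb₁ : ∀ y, ∃ m, ι m = b y := fun y => hb ⟨y, rfl⟩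
  have hb₁' : ∀ y, ∃ m, ι m = b' y := fun y => hb' ⟨y, rfl⟩
  choose m hm using hb₁
  choose m' hm' using hb₁'
  refine (h Y hY b b' hb hb' hbb').imp fun n hn => ?_
  refine hN.lascarDistLE_congr (c := fun c : C => ι c) (hC.trans_le hκ)
    (hN.sum_lt (hX.trans_le hκ) (hY.trans_le hκ)) (by rw [image_eq_range]) ?_ hn
  refine hγα.reindex (Sum.elim (fun c : C => .inl c) (Sum.elim
    (Sum.elim .inr fun y => .inl (m y)) (Sum.elim .inr fun y => .inl (m' y)))) ?_ ?_
  · rintro (c | (x | y) | (x | y)) <;> simp [hm, hm']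
  · rintro (c | (x | y) | (x | y)) <;> simp [hm, hm']

/-- Iterated realisations `α_i` of the type of `β` over `M` that are Lascar invariant over `M` and
the earlier `α_j`. -/
theorem PreservesIndiscernibles.exists_tensorPower [Nonempty M] [Nonempty N]
    (hM : IsMonster T κ M) (hN : IsMonster T κ' N)
    (hκ : κ ≤ κ') (hMN : #M < κ') (hthick : IsThick L N) {ι : M →[L] N} {C : Set M} (hC : #C < κ)
    (hX : #X < κ) {β : X → N} (hβ : PreservesIndiscernibles L κ (ι '' C) (range ι) β) :
    ∃ α : ℕ → X → N, ∀ i, PosEquiv L (Sum.elim ι β) (Sum.elim ι (α i)) ∧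
      LsInvariantOver L κ (ι '' C) (range ι ∪ {e | ∃ j < i, e ∈ range (α j)}) (α i) := by
  have h : ∀ B : Set N, ∃ γ : X → N, #B < κ' → PosEquiv L (Sum.elim ι β) (Sum.elim ι γ) ∧
      LsInvariantOver L κ (ι '' C) B γ := by
    intro B
    by_cases hB : #B < κ'
    · obtain ⟨γ, hγ⟩ := hβ.exists_lsInvariantOver hM hN hκ hMN hthick hC hX hB
      exact ⟨γ, fun _ => hγ⟩
    · exact ⟨β, fun h => absurd h hB⟩
  choose F hF using h
  let B : ℕ → Set N := fun i => Nat.rec (range ι) (fun _ B => B ∪ range (F B)) i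
  have hBs : ∀ i, B (i + 1) = B i ∪ range (F (B i)) := fun i => rfl
  have hB : ∀ i, #↥(B i) < κ' := by
    intro i
    induction i with
    | zero => exact mk_range_le.trans_lt hMN
    | succ i ih =>
      rw [hBs]
      exact (mk_union_le _ _).trans_lt
        (add_lt_of_lt hN.aleph0_lt.le ih (mk_range_le.trans_lt (hX.trans_le hκ)))
  have hB' : ∀ i, B i = range ι ∪ {e | ∃ j < i, e ∈ range (F (B j))} := by
    intro i
    induction i with
    | zero => simp [B]
    | succ i ih =>
      rw [hBs, ih, union_assoc, ← ih]
      congr 1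
      ext e
      simp only [mem_union, mem_ofPred_eq, Nat.lt_succ_iff_lt_or_eq, or_and_right, exists_or,
        exists_eq_left]
  refine ⟨fun i => F (B i), fun i => ?_⟩
  rw [← hB' i]
  exact hF _ (hB i)

/-- The heart of the argument: `a_{<n}` followed by the first `k` tuples `α_i` has the same type
over `C` as `a_{<n+k}`. In the induction step the block `α_{<k}` may be replaced by the block
`a_n, …, a_{n+k-1}`, because the two are consecutive blocks of an indiscernible sequence and
hence have the same Lascar strong type, which `α_k` cannot distinguish. -/
theorem posEquiv_append (hM : IsMonster T κ M) (hN : IsMonster T κ' N) (hκ : κ ≤ κ')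
    {ι : M →[L] N} {C : Set M} (hC : #C < κ) (hX : #X < κ) {a : ℕ → X → M} {β : X → N}
    {α : ℕ → X → N} (hind : IsIndiscernible L (ι '' C) fun i x => ι (a i x))
    (hβ : ∀ n, PosEquiv L
        (Sum.elim (fun c : C => ι c) (Sum.elim (fun p : Fin n × X => ι (a p.1 p.2)) β))
        (Sum.elim (fun c : C => ι c)
          (Sum.elim (fun p : Fin n × X => ι (a p.1 p.2)) fun x => ι (a n x))))
    (hα : ∀ i, PosEquiv L (Sum.elim ι β) (Sum.elim ι (α i)) ∧
      LsInvariantOver L κ (ι '' C) (range ι ∪ {e | ∃ j < i, e ∈ range (α j)}) (α i)) (k : ℕ) :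
    ∀ n, PosEquiv L
      (Sum.elim (fun c : C => ι c) fun p : (Fin n ⊕ Fin k) × X =>
        Sum.elim (fun i : Fin n => fun x => ι (a i x)) (fun i : Fin k => α i) p.1 p.2)
      (Sum.elim (fun c : C => ι c) fun p : (Fin n ⊕ Fin k) × X =>
        ι (a (Sum.elim (fun i : Fin n => (i : ℕ)) (fun i : Fin k => n + i) p.1) p.2)) := by
  have hc : range (fun c : C => ι c) = ι '' C := by rw [image_eq_range]
  have hind' := (isIndiscernible_iff_of_range_eq hc).1 hind
  induction k with
  | zero =>
    intro n
    refine (PosEquiv.refl (Sum.elim (fun c : C => ι c) fun p : Fin n × X => ι (a p.1 p.2))).reindex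
      (Sum.map id fun p => (Sum.elim id Fin.elim0 p.1, p.2)) ?_ ?_
    · rintro (c | ⟨i | i, x⟩)
      exacts [rfl, rfl, i.elim0]
    · rintro (c | ⟨i | i, x⟩)
      exacts [rfl, rfl, i.elim0]
  | succ k ih =>
    intro n
    let u : (Fin n ⊕ Fin k) × X → N := fun p =>
      ι (a (Sum.elim (fun i : Fin n => (i : ℕ)) (fun i : Fin k => n + i) p.1) p.2)
    let v : (Fin n ⊕ Fin k) × X → N := fun p =>
      Sum.elim (fun i : Fin n => fun x => ι (a i x)) (fun i : Fin k => α i) p.1 p.2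
    let u' : (Fin n ⊕ Fin k) × X → N := fun p =>
      ι (a (Sum.elim (fun i : Fin n => (i : ℕ)) (fun i : Fin k => n + k + i) p.1) p.2)
    have hY : #((Fin n ⊕ Fin k) × X) < κ := hM.countable_prod_lt hX
    have huu' : LascarDistLE L (ι '' C) 1 u u' := by
      let idx : ℕ → Fin n ⊕ Fin k → ℕ := fun j =>
        Sum.elim (fun i => (i : ℕ)) fun i => n + k * j + i
      have hblocks := hind'.blocks idx (by
        have hlt : ∀ j j', j < j' → k * j + k ≤ k * j' := fun j j' h => by
          rw [← Nat.mul_succ]; exact Nat.mul_le_mul_left _ h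
        intro j j' i i' h1 h2 p p'
        rcases p with p | p <;> rcases p' with p' | p'
        · simp [idx]
        · simp only [idx, Sum.elim_inl, Sum.elim_inr]; omega
        · simp only [idx, Sum.elim_inl, Sum.elim_inr]; omega
        · simp only [idx, Sum.elim_inr]
          have := p.2
          have := p'.2
          rcases lt_trichotomy j j' with hj | rfl | hj
          · have := hlt _ _ hj
            have := hlt _ _ (h1.1 hj)
            omega
          · obtain rfl : i = i' := by omega
            omega
          · have := hlt _ _ hj
            have := hlt _ _ (h2.1 hj)
            omega)
      have := ((isIndiscernible_iff_of_range_eq hc).2 hblocks).lascarDistLE 0 1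
      simpa [idx, u, u'] using this
    have huv : LsEquiv L (ι '' C) u v := by
      refine ⟨1, hN.lascarDistLE_congr (c := fun c : C => ι c) (hC.trans_le hκ)
        (hY.trans_le hκ) hc ?_ huu'⟩
      refine (ih (n + k)).symm.reindex (Sum.map id (Sum.elim
        (fun p => (.inl (Sum.elim (Fin.castAdd k) (Fin.natAdd n) p.1), p.2))
        fun p => (Sum.map (Fin.castAdd k) id p.1, p.2))) ?_ ?_
      · rintro (c | ⟨i | i, x⟩ | ⟨i | i, x⟩) <;> simp [u, u']
      · rintro (c | ⟨i | i, x⟩ | ⟨i | i, x⟩) <;> simp [u, v]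
    have h1 : PosEquiv L (Sum.elim (fun c : C => ι c) (Sum.elim (α k) u))
        (Sum.elim (fun c : C => ι c) (Sum.elim (α k) v)) :=
      (sameType_iff_of_range_eq hc).1 (((hα k).2 _ hY u v
        (range_subset_iff.2 fun p => .inl ⟨_, rfl⟩) (range_subset_iff.2 (by
          rintro ⟨i | i, x⟩
          · exact .inl ⟨_, rfl⟩
          · exact .inr ⟨i, i.2, x, rfl⟩)) huv).sameType)
    have h2 : PosEquiv L (Sum.elim (fun c : C => ι c) (Sum.elim (α k) u))
        (Sum.elim (fun c : C => ι c) (Sum.elim β u)) := by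
      refine (hα k).1.symm.reindex (Sum.elim (fun c : C => .inl c) (Sum.elim .inr fun p => .inl
        (a (Sum.elim (fun i : Fin n => (i : ℕ)) (fun i : Fin k => n + i) p.1) p.2))) ?_ ?_ <;>
      · rintro (c | x | p) <;> rfl
    have h3 : PosEquiv L (Sum.elim (fun c : C => ι c) (Sum.elim β u))
        (Sum.elim (fun c : C => ι c) (Sum.elim (fun x => ι (a (n + k) x)) u)) := by
      refine (hβ (n + k)).reindex (Sum.map id (Sum.elim .inr fun p => .inl
        (Sum.elim (Fin.castAdd k) (Fin.natAdd n) p.1, p.2))) ?_ ?_ <;>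
      · rintro (c | x | ⟨i | i, x⟩) <;> simp [u]
    refine (h1.symm.trans (h2.trans h3)).reindex (Sum.map id fun p => Sum.elim
      (fun i : Fin n => .inr (.inl i, p.2))
      (fun i : Fin (k + 1) => Fin.lastCases (motive := fun _ => X ⊕ (Fin n ⊕ Fin k) × X)
        (.inl p.2) (fun i => .inr (.inr i, p.2)) i) p.1) ?_ ?_
    · rintro (c | ⟨i | i, x⟩)
      · rfl
      · rfl
      · refine Fin.lastCases ?_ (fun i => ?_) i <;> simp [v]
    · rintro (c | ⟨i | i, x⟩)
      · rfl
      · rfl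
      · refine Fin.lastCases ?_ (fun i => ?_) i <;> simp [u]

/-- If `α` continues `a` to a `C`-indiscernible sequence of order type `ω + ω`, then `a` and `α`
are at Lascar distance at most one over `C`: stretched to order type `ω · ω`, the sequence cuts into
an indiscernible sequence of `ω`-blocks. -/
theorem lascarDistLE_one_of_append [Nonempty N] (hN : IsMonster T κ N) {A : Type w}
    (hA : #A < κ) (hX : #X < κ)
    {C : Set N} {c : A → N} (hc : range c = C) {a α : ℕ → X → N} (hind : SameEM L c a c a)
    (h : ∀ n, PosEquiv L
      (Sum.elim c fun p : (Fin n ⊕ Fin n) × X =>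
        Sum.elim (fun i : Fin n => a i) (fun i : Fin n => α i) p.1 p.2)
      (Sum.elim c fun p : (Fin n ⊕ Fin n) × X =>
        a (Sum.elim (fun i : Fin n => (i : ℕ)) (fun i : Fin n => n + i) p.1) p.2)) :
    LascarDistLE L C 1 (fun p : ℕ × X => a p.1 p.2) fun p : ℕ × X => α p.1 p.2 := by
  let w : ℕ ⊕ₗ ℕ → X → N := fun i => Sum.elim a α (ofLex i)
  have hw : SameEM L c w c a := by
    intro m f g hf hg
    obtain ⟨n, hn⟩ : ∃ n : ℕ, ∀ i, Sum.elim id id (ofLex (f i)) < n :=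
      ⟨Finset.univ.sup (fun i => Sum.elim id id (ofLex (f i))) + 1, fun i =>
        Nat.lt_succ_of_le (Finset.le_sup (f := fun i => Sum.elim id id (ofLex (f i)))
          (Finset.mem_univ i))⟩
    have hk : ∀ i, ∃ p : Fin n ⊕ Fin n,
        Sum.map (fun i : Fin n => (i : ℕ)) (fun i : Fin n => (i : ℕ)) p = ofLex (f i) := by
      intro i
      have := hn i
      rcases hi : ofLex (f i) with j | j
      · rw [hi] at this; exact ⟨.inl ⟨j, this⟩, rfl⟩
      · rw [hi] at this; exact ⟨.inr ⟨j, this⟩, rfl⟩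
    choose k hk using hk
    have hs : StrictMono fun i => Sum.elim (fun i : Fin n => (i : ℕ)) (fun i : Fin n => n + i)
        (k i) := by
      intro i j hij
      have hlt := hf hij
      change Sum.elim _ _ (k i) < Sum.elim _ _ (k j)
      rw [Sum.Lex.lt_def, ← hk i, ← hk j] at hlt
      revert hlt
      rcases k i with p | p <;> rcases k j with q | q <;> simp <;> omega
    refine PosEquiv.trans ((h n).reindex (Sum.map id fun p => (k p.1, p.2)) ?_ fun _ => rfl)
      ((hind m _ g hs hg).reindex id ?_ fun _ => rfl)
    · rintro (x | ⟨i, x⟩)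
      · rfl
      · simp only [Sum.elim_inr, Sum.map_inr, w, ← hk i]
        rcases k i with p | p <;> rfl
    · rintro (x | ⟨i, x⟩) <;> rfl
  have : Countable (ℕ ×ₗ ℕ) := inferInstanceAs (Countable (ℕ × ℕ))
  obtain ⟨e, he⟩ := hind.exists_stretch hN hA hX (ℕ ×ₗ ℕ)
  have hblocks := (he.trans_indisc he).blocks (fun j i : ℕ => toLex (j, i)) (by
    intro j j' i i' h1 h2 p p'
    simp only [Prod.Lex.toLex_lt_toLex]
    omega)
  have hdist := ((isIndiscernible_iff_of_range_eq hc).2 hblocks).lascarDistLE 0 1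
  refine hN.lascarDistLE_congr hA (hN.countable_prod_lt hX) hc ?_ hdist
  have hew := (he.trans_indisc hw).posEquiv (J := ℕ ⊕ ℕ)
    (f := Sum.elim (fun i => toLex (0, i)) fun i => toLex (1, i)) (g := toLex) (by
      rintro (i | i) (j | j) <;> simp [Prod.Lex.toLex_lt_toLex])
  refine hew.reindex (Sum.map id (Sum.elim (fun p => (.inl p.1, p.2)) fun p => (.inr p.1, p.2)))
    ?_ ?_ <;>
  · rintro (x | p | p) <;> rfl

end Morley

end PosLogic

theorem mainTheorem11 {L : FirstOrder.Language.{u, v}} (T : L.Theory) (hT : IsPositiveTheory T)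
    (κ κ' : Cardinal.{w})
    (M : Type w) [L.Structure M] [Nonempty M] (hM : IsMonster T κ M)
    (N : Type w) [L.Structure N] (hN : IsMonster T κ' N)
    (hκ : κ ≤ κ') (hMN : #M < κ') (ι : M →[L] N)
    (hthick : IsThick L M)
    (C : Set M) (hC : #C < κ) (X : Type w) (hX : #X < κ) (a : ℕ → X → M)
    (hind : IsIndiscernible L C a)
    (hindep : ∀ i : ℕ, ILsIndep κ ι C (a i) {e | ∃ j < i, e ∈ range (a j)}) :
    ∃ q : GlobalType L M X, q.IsLsInvariant κ ι C ∧ q.IsMorleySequence κ ι C a := by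
  have : Nonempty N := ‹Nonempty M›.map ι
  have hι := hM.isImmersion hN ι
  have hthickN := hthick.of_hom hM hN ι
  have hX' := hX.trans_le hκ
  have hc : range (fun c : C => ι c) = ι '' C := by rw [image_eq_range]
  obtain ⟨β, hβ, hβa⟩ := exists_continuation hM hN hκ hMN hthickN ι hX hind hindep
  obtain ⟨q, hq⟩ := exists_globalType hM hN hMN hX' ι β
  have hqβ : ∀ α : X → N, q.IsRealizedBy ι α ↔ PosEquiv L (Sum.elim ι β) (Sum.elim ι α) := by
    intro α
    refine ⟨fun h => hN.posEquiv_of_posLE fun φ hφ hr => h φ (hq ▸ ⟨hφ, hr⟩), fun h φ hφ => ?_⟩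
    rw [hq] at hφ
    exact (h φ hφ.1).1 hφ.2
  have hind' : SameEM L (fun c : C => ι c) (fun i x => ι (a i x)) (fun c : C => ι c)
      fun i x => ι (a i x) := by
    refine ((isIndiscernible_iff_of_range_eq Subtype.range_val).1 hind).transfer
      ((hι.posEquiv _).symm.reindex id (fun _ => rfl) ?_)
    rintro (c | p) <;> rfl
  refine ⟨q, fun α hα => ?_, ?_⟩
  · obtain ⟨γ, hγ, hγM⟩ := hβ.exists_lsInvariantOver hM hN hκ hMN hthickN hC hX
      (mk_range_le.trans_lt hMN)
    exact hγM.congr hN hκ hC hX (hγ.symm.trans ((hqβ α).1 hα))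
  · obtain ⟨α, hα⟩ := hβ.exists_tensorPower hM hN hκ hMN hthickN hC hX
    refine ⟨α, fun i => ⟨(hqβ _).2 (hα i).1, (hα i).2⟩, 1, ?_⟩
    exact lascarDistLE_one_of_append hN (hC.trans_le hκ) hX' hc hind' fun n =>
      posEquiv_append hM hN hκ hC hX ((isIndiscernible_iff_of_range_eq hc).2 hind') hβa hα n n
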